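/- Let $f:(-1,1)\to\mathbb{R}$ be a non-constant operator monotone function, i.e. for every $n\in\mathbb{N}$ and all Hermitian matrices $A,B\in M_n(\mathbb{C})$ with spectra contained in $(-1,1)$, $A\le B$ implies $f(A)\le f(B)$, where $X\le Y$ means that $Y-X$ is positive semidefinite and $f(A)$ is given by the spectral functional calculus (no continuity of $f$ is assumed). Then $f$ is differentiable at $0$, and there is a unique Borel probability measure $\mu$ on $[-1,1]$ such that $$f(x)=f(0)+f'(0)\int_{[-1,1]}\frac{x}{1-\lambda x}\,d\mu(\lambda)\qquad\text{for all }x\in(-1,1).$$ -/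

import Mathlib

open scoped ComplexOrder

/-- `f` is matrix monotone of degree `n` on `J ⊆ ℝ`: for all Hermitian complex `n × n` matrices
`A`, `B` with spectra in `J`, `A ≤ B` (Loewner order) implies `f(A) ≤ f(B)`.
Here `cfc f A` is the functional calculus of a Hermitian matrix; the spectrum of `A` is finite, so
`f` is automatically continuous on it and no continuity of `f` on `J` is involved. Only the values
of `f` on `J` matter. -/
def MatrixMonotoneOfDegree (n : ℕ) (J : Set ℝ) (f : ℝ → ℝ) : Prop :=
  ∀ A B : Matrix (Fin n) (Fin n) ℂ, A.IsHermitian → B.IsHermitian →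
    spectrum ℝ A ⊆ J → spectrum ℝ B ⊆ J →
    (B - A).PosSemidef → (cfc f B - cfc f A).PosSemidef

/-- `f` is operator monotone on `J`: matrix monotone of every degree. -/
def OperatorMonotone (J : Set ℝ) (f : ℝ → ℝ) : Prop :=
  ∀ n : ℕ, MatrixMonotoneOfDegree n J f

/-! The proof is algebraic: the backward shift acts on operator monotone functions, and positivity
of the moments it generates yields the measure.

Compressing by an isometry `V` shows that `(1 + t) f(t)` satisfies an operator Jensen inequality.
With `C = (1 + Z)^(1/2) V`, the operator `C Cᴴ` lies below `1 + Z` and acts on the range of `C` as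
`Cᴴ C = 1 + VᴴZV`, so monotonicity of `f` can be conjugated by `C`. As continuity is not assumed,
the argument keeps a slack `δ`; its scalar case already forces continuity, and then `δ → 0`
(`OperatorMonotone.operatorJensen_one_add_mul`). Reflection gives the same for `(t - 1) f(t)`, and
convexity of the two products makes `f` differentiable.

Conversely, if `F` satisfies Jensen and `F(0) = 0`, then `F(t) / t`, extended continuously, is
operator monotone (`OperatorJensen.operatorMonotone_slope`). Since `0` is interior, the matrices are
indefinite: for invertible `A ≤ B` with `B⁻¹ ≤ A⁻¹` a contraction carries `B₊ ⊕ A₋` to `A₊ ⊕ B₋`,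
and contractive Jensen applies. The inverse inequality holds along subsegments from `A` to `B` that
meet no singular matrix, and continuity joins them.

Let `f(0) = 0` and `S f = f / t - f'(0)`. The two directions together say that `f + S f` and `f - S
f` are again operator monotone and vanish at `0`. Hence `L(p) = (p(S) f)'(0)` is nonnegative on
every `(1 + X)^j (1 - X)^k`, and Hausdorff's theorem represents `L / f'(0)` by a probability
measure. The functions `f ± Sⁿ f` are also monotone, so `|Sⁿ f| ≤ |f|`: the Taylor series of `f`
converges to `f` on all of `(-1, 1)`, and its coefficients are the moments `L(Xⁿ)`. If `f'(0) = 0`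
they all vanish and `f` is constant. Uniqueness holds because the integrals determine the moments.
-/

open Matrix Polynomial Set Filter Topology
open scoped MatrixOrder

set_option linter.unusedSectionVars false

/-! ### Functional calculus of Hermitian matrices. -/

section FunctionalCalculus

/-- Both `1 + A` and `1 - A` are positive definite; for Hermitian `A` this says that the spectrum
of `A` lies in `(-1, 1)`. -/
def UnitSpectrum {ι : Type} [DecidableEq ι] (A : Matrix ι ι ℂ) : Prop :=
  (1 + A).PosDef ∧ (1 - A).PosDef

theorem UnitSpectrum.isHermitian {ι : Type} [DecidableEq ι] {A : Matrix ι ι ℂ}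
    (h : UnitSpectrum A) : A.IsHermitian := by
  have := h.1.isHermitian.sub (isHermitian_one (n := ι) (α := ℂ))
  simpa using this

variable {ι κ : Type} [Fintype ι] [DecidableEq ι] [Fintype κ] [DecidableEq κ]

theorem continuousOn_spectrum (f : ℝ → ℝ) (A : Matrix ι ι ℂ) : ContinuousOn f (spectrum ℝ A) :=
  A.finite_real_spectrum.continuousOn f

theorem exists_polynomial_eqOn (f : ℝ → ℝ) {s : Set ℝ} (hs : s.Finite) :
    ∃ q : ℝ[X], ∀ t ∈ s, q.eval t = f t := by
  refine ⟨Lagrange.interpolate hs.toFinset id f, fun t ht => ?_⟩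
  exact Lagrange.eval_interpolate_at_node (v := id) f (Function.injective_id.injOn)
    (hs.mem_toFinset.2 ht)

theorem cfc_eq_aeval {A : Matrix ι ι ℂ} (hA : A.IsHermitian) {f : ℝ → ℝ} {q : ℝ[X]}
    (hq : ∀ t ∈ spectrum ℝ A, q.eval t = f t) : cfc f A = aeval A q := by
  rw [← cfc_polynomial q A hA]
  exact cfc_congr fun t ht => (hq t ht).symm

theorem cfc_isHermitian (f : ℝ → ℝ) (A : Matrix ι ι ℂ) : (cfc f A).IsHermitian :=
  cfc_predicate f A

theorem cfc_mul_fun (f g : ℝ → ℝ) (A : Matrix ι ι ℂ) :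
    cfc (fun t => f t * g t) A = cfc f A * cfc g A :=
  cfc_mul f g A (continuousOn_spectrum _ _) (continuousOn_spectrum _ _)

theorem cfc_add_fun (f g : ℝ → ℝ) (A : Matrix ι ι ℂ) :
    cfc (fun t => f t + g t) A = cfc f A + cfc g A :=
  cfc_add A f g (continuousOn_spectrum _ _) (continuousOn_spectrum _ _)

theorem cfc_sub_fun (f g : ℝ → ℝ) (A : Matrix ι ι ℂ) :
    cfc (fun t => f t - g t) A = cfc f A - cfc g A :=
  cfc_sub f g A (continuousOn_spectrum _ _) (continuousOn_spectrum _ _)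

theorem cfc_comp_fun (g f : ℝ → ℝ) {A : Matrix ι ι ℂ} (hA : A.IsHermitian) :
    cfc (fun t => g (f t)) A = cfc g (cfc f A) :=
  cfc_comp' g f A ((A.finite_real_spectrum.image f).continuousOn g) (continuousOn_spectrum _ _) hA

theorem cfc_nonneg_fun {f : ℝ → ℝ} {A : Matrix ι ι ℂ} (h : ∀ t ∈ spectrum ℝ A, 0 ≤ f t) :
    0 ≤ cfc f A := cfc_nonneg h

theorem aeval_intertwine (q : ℝ[X]) {T : Matrix κ κ ℂ} {Y : Matrix ι ι ℂ} {C : Matrix κ ι ℂ}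
    (h : T * C = C * Y) : aeval T q * C = C * aeval Y q := by
  induction q using Polynomial.induction_on' with
  | add p q hp hq => rw [map_add, map_add, Matrix.add_mul, Matrix.mul_add, hp, hq]
  | monomial n a =>
    have hn : T ^ n * C = C * Y ^ n := by
      induction n with
      | zero => simp
      | succ n ih => rw [pow_succ, pow_succ, Matrix.mul_assoc, h, ← Matrix.mul_assoc, ih,
          Matrix.mul_assoc]
    rw [aeval_monomial, aeval_monomial, ← Algebra.smul_def, ← Algebra.smul_def, Matrix.smul_mul,
      Matrix.mul_smul, hn]

/-- Both spectra are finite, so a single polynomial interpolates `f` on their union, and polynomials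
respect intertwining. No regularity of `f` enters. -/
theorem cfc_intertwine (f : ℝ → ℝ) {T : Matrix κ κ ℂ} {Y : Matrix ι ι ℂ} (hT : T.IsHermitian)
    (hY : Y.IsHermitian) {C : Matrix κ ι ℂ} (h : T * C = C * Y) :
    cfc f T * C = C * cfc f Y := by
  obtain ⟨q, hq⟩ := exists_polynomial_eqOn f (T.finite_real_spectrum.union Y.finite_real_spectrum)
  rw [cfc_eq_aeval hT fun t ht => hq t (Or.inl ht), cfc_eq_aeval hY fun t ht => hq t (Or.inr ht)]
  exact aeval_intertwine q h

theorem cfc_one_add {A : Matrix ι ι ℂ} (hA : A.IsHermitian) :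
    cfc (fun t : ℝ => 1 + t) A = 1 + A := by
  rw [cfc_add_fun, cfc_const_one ℝ A hA.isSelfAdjoint, cfc_id' ℝ A hA.isSelfAdjoint]

theorem cfc_one_sub {A : Matrix ι ι ℂ} (hA : A.IsHermitian) :
    cfc (fun t : ℝ => 1 - t) A = 1 - A := by
  rw [cfc_sub_fun, cfc_const_one ℝ A hA.isSelfAdjoint, cfc_id' ℝ A hA.isSelfAdjoint]

theorem unitSpectrum_iff {A : Matrix ι ι ℂ} (hA : A.IsHermitian) :
    spectrum ℝ A ⊆ Ioo (-1) 1 ↔ UnitSpectrum A := by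
  rw [UnitSpectrum, ← isStrictlyPositive_iff_posDef, ← isStrictlyPositive_iff_posDef,
    ← cfc_one_add hA, ← cfc_one_sub hA,
    cfc_isStrictlyPositive_iff _ A (continuousOn_spectrum _ _) hA.isSelfAdjoint,
    cfc_isStrictlyPositive_iff _ A (continuousOn_spectrum _ _) hA.isSelfAdjoint]
  constructor
  · intro h
    exact ⟨fun x hx => by linarith [(h hx).1], fun x hx => by linarith [(h hx).2]⟩
  · exact fun h x hx => ⟨by linarith [h.1 x hx], by linarith [h.2 x hx]⟩

theorem UnitSpectrum.subset {A : Matrix ι ι ℂ} (h : UnitSpectrum A) :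
    spectrum ℝ A ⊆ Ioo (-1) 1 := (unitSpectrum_iff h.isHermitian).2 h

/-- Operator monotone functions on `(-1, 1)` are monotone on matrices with arbitrary finite
index type. -/
theorem OperatorMonotone.cfc_le {f : ℝ → ℝ} (hf : OperatorMonotone (Ioo (-1) 1) f)
    {A B : Matrix ι ι ℂ} (hA : UnitSpectrum A) (hB : UnitSpectrum B) (h : A ≤ B) :
    cfc f A ≤ cfc f B := by
  classical
  let e := Fintype.equivFin ι
  have key : ∀ {M : Matrix ι ι ℂ}, UnitSpectrum M → (M.submatrix e.symm e.symm).IsHermitian ∧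
      spectrum ℝ (M.submatrix e.symm e.symm) ⊆ Ioo (-1) 1 ∧
      cfc f (M.submatrix e.symm e.symm) = (cfc f M).submatrix e.symm e.symm := by
    intro M hM
    have h1 : M.submatrix e.symm e.symm = reindexAlgEquiv ℝ ℂ e M := rfl
    have hs : spectrum ℝ (M.submatrix e.symm e.symm) = spectrum ℝ M := by
      rw [h1, AlgEquiv.spectrum_eq]
    have hH := hM.isHermitian.submatrix e.symm
    refine ⟨hH, hs ▸ hM.subset, ?_⟩
    obtain ⟨q, hq⟩ := exists_polynomial_eqOn f M.finite_real_spectrum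
    rw [cfc_eq_aeval hM.isHermitian hq, cfc_eq_aeval hH (q := q) (by rwa [hs]), h1,
      aeval_algHom_apply]
    rfl
  obtain ⟨a1, a2, a3⟩ := key hA
  obtain ⟨b1, b2, b3⟩ := key hB
  have := hf _ _ _ a1 b1 a2 b2 (by
    have := (Matrix.le_iff.1 h).submatrix e.symm
    rwa [submatrix_sub] at this)
  rw [a3, b3] at this
  rw [Matrix.le_iff]
  rw [← posSemidef_submatrix_equiv e.symm]
  rwa [submatrix_sub]

/-- On a finite spectrum pointwise convergence is uniform. -/
theorem tendsto_cfc_of_tendsto {α : Type*} {l : Filter α} {F : α → ℝ → ℝ} {f : ℝ → ℝ}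
    {A : Matrix ι ι ℂ} (h : ∀ t ∈ spectrum ℝ A, Tendsto (fun x => F x t) l (𝓝 (f t))) :
    Tendsto (fun x => cfc (F x) A) l (𝓝 (cfc f A)) := by
  refine tendsto_cfc_fun ?_ (Eventually.of_forall fun _ => continuousOn_spectrum _ _)
  intro u hu
  have := (A.finite_real_spectrum.eventually_all (l := l)
    (p := fun t x => (f t, F x t) ∈ u)).2 fun t ht => (h t ht).eventually (by
      exact UniformSpace.ball_mem_nhds (f t) hu)
  exact this

open scoped Matrix.Norms.L2Operator in
theorem matrix_le_of_tendsto {α : Type*} {l : Filter α} [l.NeBot] {F G : α → Matrix ι ι ℂ}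
    {A B : Matrix ι ι ℂ} (hF : Tendsto F l (𝓝 A)) (hG : Tendsto G l (𝓝 B))
    (h : ∀ᶠ x in l, F x ≤ G x) : A ≤ B :=
  le_of_tendsto_of_tendsto hF hG h

end FunctionalCalculus

/-! ### Operator Jensen inequality with slack. -/

section Jensen

variable {ι κ : Type} [Fintype ι] [DecidableEq ι] [Fintype κ] [DecidableEq κ]

theorem conj_le_conj {A B : Matrix κ κ ℂ} (h : A ≤ B) (C : Matrix κ ι ℂ) :
    Cᴴ * A * C ≤ Cᴴ * B * C := by
  rw [Matrix.le_iff] at *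
  have := h.conjTranspose_mul_mul_same C
  rwa [Matrix.mul_sub, Matrix.sub_mul] at this

theorem exists_smul_one_le {A : Matrix κ κ ℂ} (hA : A.PosDef) :
    ∃ η : ℝ, 0 < η ∧ η • (1 : Matrix κ κ ℂ) ≤ A := by
  have hspec : ∀ x ∈ spectrum ℝ A, 0 < x := by
    intro x hx
    rw [hA.isHermitian.spectrum_real_eq_range_eigenvalues] at hx
    obtain ⟨i, rfl⟩ := hx
    exact hA.eigenvalues_pos i
  obtain ⟨η, h0, h1⟩ : ∃ η : ℝ, 0 < η ∧ ∀ x ∈ spectrum ℝ A, η ≤ x := by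
    have : ∀ᶠ η in 𝓝[>] (0 : ℝ), ∀ x ∈ spectrum ℝ A, η ≤ x := by
      rw [A.finite_real_spectrum.eventually_all]
      intro x hx
      filter_upwards [Ioo_mem_nhdsGT (hspec x hx)] with η h using h.2.le
    obtain ⟨η, h, h'⟩ := (this.and self_mem_nhdsWithin).exists
    exact ⟨η, h', h⟩
  refine ⟨η, h0, ?_⟩
  have := (algebraMap_le_iff_le_spectrum (r := η) (a := A) hA.isHermitian.isSelfAdjoint).2 h1
  rwa [Algebra.algebraMap_eq_smul_one] at this

theorem UnitSpectrum.scale {A : Matrix ι ι ℂ} (hA : UnitSpectrum A) {δ : ℝ} (h0 : 0 < δ)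
    (h1 : δ < 1) : UnitSpectrum ((1 - δ) • (1 + A) - 1) := by
  constructor
  · have : 1 + ((1 - δ) • (1 + A) - 1) = (1 - δ) • (1 + A) := by abel
    rw [this]
    exact hA.1.smul (by linarith)
  · have : 1 - ((1 - δ) • (1 + A) - 1) = (1 - A) + δ • (1 + A) := by
      rw [sub_smul, one_smul]; abel
    rw [this]
    exact hA.2.add (hA.1.smul h0)

theorem UnitSpectrum.conj {Z : Matrix κ κ ℂ} (hZ : UnitSpectrum Z) {V : Matrix κ ι ℂ}
    (hV : Vᴴ * V = 1) : UnitSpectrum (Vᴴ * Z * V) := by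
  have hinj : Function.Injective V.mulVec := by
    intro x y h
    have := congrArg (Vᴴ.mulVec) h
    simpa [hV] using this
  constructor
  · have := hZ.1.conjTranspose_mul_mul_same hinj
    rwa [Matrix.mul_add, Matrix.add_mul, Matrix.mul_one, hV] at this
  · have := hZ.2.conjTranspose_mul_mul_same hinj
    rwa [Matrix.mul_sub, Matrix.sub_mul, Matrix.mul_one, hV] at this

/-- If `C` is injective on the left and `Cᴴ C` is positive definite, then a compressed copy of
`C Cᴴ` can be completed to an operator below `M` that acts on the range of `C` like `Cᴴ C`. -/
theorem exists_completion {M : Matrix κ κ ℂ} {C : Matrix κ ι ℂ} (hC : (Cᴴ * C).PosDef)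
    (hCM : C * Cᴴ ≤ M) (hM : M.PosDef) {δ : ℝ} (h0 : 0 < δ) (h1 : δ < 1) :
    ∃ T : Matrix κ κ ℂ, T.PosDef ∧ T ≤ M ∧ T * C = C * ((1 - δ) • (Cᴴ * C)) := by
  -- The slack `δ M` pays for a multiple `η` of the identity, which makes `T` definite off the range
  -- of `C`.
  obtain ⟨η, hη, hηM⟩ := exists_smul_one_le (hM.smul h0)
  set G := Cᴴ * C with hG
  have hGG : G⁻¹ * G = 1 := Matrix.nonsing_inv_mul _ ((Matrix.isUnit_iff_isUnit_det _).1 hC.isUnit)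
  set P := C * G⁻¹ * Cᴴ with hP
  have hPC : P * C = C := by
    rw [hP, Matrix.mul_assoc, Matrix.mul_assoc, ← hG, hGG, Matrix.mul_one]
  have hP0 : P.PosSemidef := hC.inv.posSemidef.mul_mul_conjTranspose_same C
  have hPP : P * P = P := by
    nth_rewrite 2 [hP]
    rw [← Matrix.mul_assoc, ← Matrix.mul_assoc, hPC]
  have hPH : Pᴴ = P := hP0.isHermitian
  have hQ0 : (1 - P).PosSemidef := by
    have : 1 - P = (1 - P)ᴴ * (1 - P) := by
      rw [conjTranspose_sub, hPH, conjTranspose_one]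
      rw [Matrix.mul_sub, Matrix.sub_mul, Matrix.sub_mul, hPP]
      simp
    rw [this]
    exact posSemidef_conjTranspose_mul_self _
  have hCC : (C * Cᴴ).PosSemidef := posSemidef_self_mul_conjTranspose C
  -- `P` is the orthogonal projection onto the range of `C`, so the second summand kills `C`.
  refine ⟨(1 - δ) • (C * Cᴴ) + η • (1 - P), ?_, ?_, ?_⟩
  · have hH : ((1 - δ) • (C * Cᴴ) + η • (1 - P)).PosSemidef :=
      (hCC.smul (by linarith)).add (hQ0.smul hη.le)
    refine PosDef.of_dotProduct_mulVec_pos hH.isHermitian fun x hx =>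
      lt_of_le_of_ne (hH.dotProduct_mulVec_nonneg x) fun h => hx ?_
    have n1 := (hCC.smul (show 0 ≤ 1 - δ by linarith)).dotProduct_mulVec_nonneg x
    have n2 := (hQ0.smul hη.le).dotProduct_mulVec_nonneg x
    rw [Matrix.add_mulVec, dotProduct_add] at h
    have z := (add_eq_zero_iff_of_nonneg n1 n2).1 h.symm
    have z1 := ((hCC.smul (show 0 ≤ 1 - δ by linarith)).dotProduct_mulVec_zero_iff x).1 z.1
    have z2 := ((hQ0.smul hη.le).dotProduct_mulVec_zero_iff x).1 z.2
    rw [Matrix.smul_mulVec, smul_eq_zero_iff_right (by linarith)] at z1 z2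
    have z3 : Cᴴ *ᵥ x = 0 := by
      have := congrArg (fun w => G⁻¹ *ᵥ (Cᴴ *ᵥ w)) z1
      simpa only [Matrix.mulVec_mulVec, ← Matrix.mul_assoc, ← hG, hGG, Matrix.one_mul,
        Matrix.mulVec_zero, Matrix.mul_assoc G⁻¹ Cᴴ] using this
    rw [Matrix.sub_mulVec, Matrix.one_mulVec, hP, ← Matrix.mulVec_mulVec, z3, Matrix.mulVec_zero,
      sub_zero] at z2
    exact z2
  · rw [Matrix.le_iff] at *
    have e : M - ((1 - δ) • (C * Cᴴ) + η • (1 - P)) =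
        (δ • M - η • 1) + η • P + (1 - δ) • (M - C * Cᴴ) := by
      module
    rw [e]
    exact (hηM.add (hP0.smul hη.le)).add (hCM.smul (by linarith))
  · rw [Matrix.add_mul, Matrix.smul_mul, Matrix.smul_mul, Matrix.sub_mul, hPC, Matrix.one_mul,
      sub_self, smul_zero, add_zero, Matrix.mul_smul, Matrix.mul_assoc]

/-- Complete `(1 - δ) C Cᴴ`, with `C = (1 + Z)^(1/2) V`, to a definite `T ≤ 1 + Z`, and conjugate
`f(T - 1) ≤ f(Z)` by `C`. On the left `T` is moved through `C`, where it becomes `(1 - δ)(1 + Y)`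
with `Y = VᴴZV`; on the right the square roots commute with `f(Z)`. The shift by `1` places the left
endpoint of the interval at `0`. -/
theorem OperatorMonotone.one_add_mul_conj_le {f : ℝ → ℝ} (hf : OperatorMonotone (Ioo (-1) 1) f)
    {Z : Matrix κ κ ℂ} (hZ : UnitSpectrum Z) {V : Matrix κ ι ℂ} (hV : Vᴴ * V = 1) {δ : ℝ}
    (h0 : 0 < δ) (h1 : δ < 1) :
    cfc (fun t => (1 + t) * f ((1 - δ) * (1 + t) - 1)) (Vᴴ * Z * V) ≤
      Vᴴ * cfc (fun t => (1 + t) * f t) Z * V := by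
  set Y := Vᴴ * Z * V with hY
  have hYU : UnitSpectrum Y := hZ.conj hV
  set S := cfc (fun t => √(1 + t)) Z with hS
  have hSH : Sᴴ = S := cfc_isHermitian _ _
  have hSS : S * S = 1 + Z := by
    rw [hS, ← cfc_mul_fun, ← cfc_one_add hZ.isHermitian]
    exact cfc_congr fun t ht => Real.mul_self_sqrt (by linarith [(hZ.subset ht).1])
  have hSfS : S * cfc f Z * S = cfc (fun t => (1 + t) * f t) Z := by
    rw [hS, ← cfc_mul_fun, ← cfc_mul_fun]
    refine cfc_congr fun t ht => ?_
    have := Real.mul_self_sqrt (show 0 ≤ 1 + t by linarith [(hZ.subset ht).1])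
    linear_combination f t * this
  have hCC : (S * V)ᴴ * (S * V) = 1 + Y := by
    rw [conjTranspose_mul, hSH, Matrix.mul_assoc, ← Matrix.mul_assoc S, hSS, Matrix.add_mul,
      Matrix.mul_add, Matrix.one_mul, hV, hY, Matrix.mul_assoc]
  have hVV : V * Vᴴ ≤ 1 := by
    rw [Matrix.le_iff]
    have : 1 - V * Vᴴ = (1 - V * Vᴴ)ᴴ * (1 - V * Vᴴ) := by
      rw [conjTranspose_sub, conjTranspose_one, conjTranspose_mul, conjTranspose_conjTranspose,
        Matrix.sub_mul, Matrix.one_mul, Matrix.mul_sub, Matrix.mul_one, ← Matrix.mul_assoc,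
        Matrix.mul_assoc V, hV, Matrix.mul_one, sub_self, sub_zero]
    rw [this]
    exact posSemidef_conjTranspose_mul_self _
  have hCM : (S * V) * (S * V)ᴴ ≤ 1 + Z := by
    have := conj_le_conj hVV S
    rw [hSH, Matrix.mul_one, hSS] at this
    rw [conjTranspose_mul, hSH]
    simpa only [Matrix.mul_assoc] using this
  obtain ⟨T, hT, hTM, hTC⟩ := exists_completion (C := S * V) (hCC ▸ hYU.1) hCM hZ.1 h0 h1
  rw [hCC] at hTC
  have hTZ : T - 1 ≤ Z := by rwa [sub_le_iff_le_add']
  have hTU : UnitSpectrum (T - 1) := by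
    refine ⟨by simpa using hT, ?_⟩
    have : 1 - (T - 1) = (1 - Z) + (Z - (T - 1)) := by abel
    rw [this]
    exact hZ.2.add_posSemidef (Matrix.le_iff.1 hTZ)
  have hYδ := hYU.scale h0 h1
  have hint := cfc_intertwine f hTU.isHermitian hYδ.isHermitian (C := S * V) (by
    rw [Matrix.sub_mul, Matrix.mul_sub, hTC, Matrix.one_mul, Matrix.mul_one])
  have hle := conj_le_conj (hf.cfc_le hTU hZ hTZ) (S * V)
  rw [Matrix.mul_assoc, hint, ← Matrix.mul_assoc, hCC] at hle
  have hcomp : cfc (fun t : ℝ => (1 - δ) * (1 + t) - 1) Y = (1 - δ) • (1 + Y) - 1 := by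
    rw [cfc_sub_fun, cfc_const_mul (1 - δ) (fun t : ℝ => 1 + t) Y (continuousOn_spectrum _ _),
      cfc_one_add hYU.isHermitian, cfc_const_one ℝ Y hYU.isHermitian.isSelfAdjoint]
  rw [cfc_mul_fun, cfc_comp_fun f _ hYU.isHermitian, hcomp, cfc_one_add hYU.isHermitian]
  refine hle.trans_eq ?_
  rw [← hSfS, conjTranspose_mul, hSH]
  simp only [Matrix.mul_assoc]

end Jensen

/-! ### Scalar consequences: continuity, convexity, differentiability. -/

section Scalar

variable {ι κ : Type} [Fintype ι] [DecidableEq ι] [Fintype κ] [DecidableEq κ]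

theorem diagonal_ofReal_isHermitian (d : ι → ℝ) :
    (diagonal fun i => (d i : ℂ)).IsHermitian :=
  isHermitian_diagonal_of_self_adjoint _ (funext fun i => Complex.conj_ofReal (d i))

theorem cfc_diagonal (f : ℝ → ℝ) (d : ι → ℝ) :
    cfc f (diagonal fun i => (d i : ℂ)) = diagonal fun i => (f (d i) : ℂ) := by
  have hH := diagonal_ofReal_isHermitian d
  obtain ⟨q, hq⟩ := exists_polynomial_eqOn f
    ((diagonal fun i => (d i : ℂ)).finite_real_spectrum.union (finite_range d))
  rw [cfc_eq_aeval hH fun t ht => hq t (Or.inl ht)]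
  have h1 : (diagonal fun i => (d i : ℂ)) = diagonalAlgHom ℝ (fun i => (d i : ℂ)) := rfl
  rw [h1, aeval_algHom_apply, diagonalAlgHom_apply]
  congr 1
  ext i
  have h2 := aeval_algHom_apply (Pi.evalAlgHom ℝ (fun _ : ι => ℂ) i) (fun i => (d i : ℂ)) q
  simp only [Pi.evalAlgHom_apply] at h2
  rw [← h2, ← hq (d i) (Or.inr (mem_range_self i))]
  exact aeval_algebraMap_apply ℂ (d i) q

theorem unitSpectrum_diagonal {d : ι → ℝ} (hd : ∀ i, d i ∈ Ioo (-1 : ℝ) 1) :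
    UnitSpectrum (diagonal fun i => (d i : ℂ)) := by
  constructor
  · rw [← diagonal_one, diagonal_add, posDef_diagonal_iff]
    intro i
    have : (0 : ℝ) < 1 + d i := by linarith [(hd i).1]
    exact_mod_cast this
  · rw [← diagonal_one, diagonal_sub, posDef_diagonal_iff]
    intro i
    have : (0 : ℝ) < 1 - d i := by linarith [(hd i).2]
    exact_mod_cast this

theorem diagonal_ofReal_le_iff {d e : ι → ℝ} :
    (diagonal fun i => (d i : ℂ)) ≤ (diagonal fun i => (e i : ℂ)) ↔ ∀ i, d i ≤ e i := by
  rw [Matrix.le_iff, diagonal_sub, posSemidef_diagonal_iff]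
  refine forall_congr' fun i => ?_
  rw [sub_nonneg]
  norm_cast

theorem OperatorMonotone.monotoneOn {f : ℝ → ℝ} (hf : OperatorMonotone (Ioo (-1) 1) f) :
    MonotoneOn f (Ioo (-1) 1) := by
  intro x hx y hy hxy
  have := hf.cfc_le (ι := Fin 1) (unitSpectrum_diagonal fun _ => hx)
    (unitSpectrum_diagonal fun _ => hy) (diagonal_ofReal_le_iff.2 fun _ => hxy)
  rw [cfc_diagonal f fun _ => x, cfc_diagonal f fun _ => y,
    diagonal_ofReal_le_iff (d := fun _ => f x) (e := fun _ => f y)] at this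
  exact this 0

/-- The column isometry with entries `√p` and `√q`. -/
noncomputable def weightColumn (p q : ℝ) : Matrix (Fin 2) (Fin 1) ℂ :=
  Matrix.of fun i _ => ((√(![p, q] i) : ℝ) : ℂ)

theorem weightColumn_conj {p q : ℝ} (hp : 0 ≤ p) (hq : 0 ≤ q) (d : Fin 2 → ℝ) :
    (weightColumn p q)ᴴ * (diagonal fun i => (d i : ℂ)) * weightColumn p q =
      diagonal fun _ : Fin 1 => ((p * d 0 + q * d 1 : ℝ) : ℂ) := by
  ext i j
  fin_cases i
  fin_cases j
  have e1 : ((√p : ℝ) : ℂ) * ((√p : ℝ) : ℂ) = p := by exact_mod_cast Real.mul_self_sqrt hp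
  have e2 : ((√q : ℝ) : ℂ) * ((√q : ℝ) : ℂ) = q := by exact_mod_cast Real.mul_self_sqrt hq
  simp [weightColumn, Matrix.mul_apply, Fin.sum_univ_two, diagonal_apply]
  linear_combination (d 0 : ℂ) * e1 + (d 1 : ℂ) * e2

theorem weightColumn_isometry {p q : ℝ} (hp : 0 ≤ p) (hq : 0 ≤ q) (hpq : p + q = 1) :
    (weightColumn p q)ᴴ * weightColumn p q = 1 := by
  have := weightColumn_conj hp hq fun _ => 1
  simpa [hpq] using this

/-- Operator Jensen inequality for compressions by isometries, on matrices with spectrum in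
`(-1, 1)`. -/
structure OperatorJensen (F : ℝ → ℝ) : Prop where
  conj_le : ∀ {ι κ : Type} [Fintype ι] [DecidableEq ι] [Fintype κ] [DecidableEq κ]
    {Z : Matrix κ κ ℂ} {V : Matrix κ ι ℂ}, UnitSpectrum Z → Vᴴ * V = 1 →
    cfc F (Vᴴ * Z * V) ≤ Vᴴ * cfc F Z * V

/-- Two functions are allowed because, before continuity is known, the slack makes the two sides of
the Jensen inequality differ. -/
theorem two_point_of_conj_le {F G : ℝ → ℝ} {p q x y : ℝ} (hp : 0 ≤ p) (hq : 0 ≤ q)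
    (h : cfc G ((weightColumn p q)ᴴ * (diagonal fun i => (![x, y] i : ℂ)) * weightColumn p q) ≤
      (weightColumn p q)ᴴ * cfc F (diagonal fun i => (![x, y] i : ℂ)) * weightColumn p q) :
    G (p * x + q * y) ≤ p * F x + q * F y := by
  rw [weightColumn_conj hp hq, cfc_diagonal, cfc_diagonal F ![x, y],
    weightColumn_conj hp hq fun i => F (![x, y] i),
    diagonal_ofReal_le_iff (d := fun _ => G (p * ![x, y] 0 + q * ![x, y] 1))
      (e := fun _ => p * F (![x, y] 0) + q * F (![x, y] 1))] at h
  simpa using h 0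

theorem pair_mem {x y : ℝ} (hx : x ∈ Ioo (-1 : ℝ) 1) (hy : y ∈ Ioo (-1 : ℝ) 1) (i : Fin 2) :
    ![x, y] i ∈ Ioo (-1 : ℝ) 1 := by
  fin_cases i
  exacts [hx, hy]

theorem OperatorJensen.convexOn {F : ℝ → ℝ} (hF : OperatorJensen F) :
    ConvexOn ℝ (Ioo (-1) 1) F := by
  refine ⟨convex_Ioo _ _, fun x hx y hy p q hp hq hpq => ?_⟩
  exact two_point_of_conj_le hp hq
    (hF.conj_le (unitSpectrum_diagonal (pair_mem hx hy)) (weightColumn_isometry hp hq hpq))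

/-- This is the slack inequality on a two-point diagonal matrix. The slack survives as the strict
inequality between `t` and the weighted mean. -/
theorem OperatorMonotone.two_point {f : ℝ → ℝ} (hf : OperatorMonotone (Ioo (-1) 1) f)
    {x y p q t : ℝ} (hx : x ∈ Ioo (-1 : ℝ) 1) (hy : y ∈ Ioo (-1 : ℝ) 1) (hp : 0 ≤ p) (hq : 0 ≤ q)
    (hpq : p + q = 1) (ht : -1 < t) (hlt : t < p * x + q * y) :
    (1 + (p * x + q * y)) * f t ≤ p * ((1 + x) * f x) + q * ((1 + y) * f y) := by
  set m := p * x + q * y with hm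
  have hm1 : 0 < 1 + m := by linarith
  have := two_point_of_conj_le hp hq (hf.one_add_mul_conj_le
    (unitSpectrum_diagonal (pair_mem hx hy)) (weightColumn_isometry hp hq hpq)
    -- This `δ` solves `(1 - δ)(1 + m) - 1 = t`.
    (δ := 1 - (1 + t) / (1 + m)) (sub_pos.2 ((div_lt_one hm1).2 (by linarith)))
    (by linarith [div_pos (show 0 < 1 + t by linarith) hm1]))
  rw [← hm] at this
  have e : (1 - (1 - (1 + t) / (1 + m))) * (1 + m) - 1 = t := by
    field_simp; ring
  simpa only [e] using this

/-- A jump at `c` is excluded by the two-point inequality: write `c + 2s` as a mean of `c - s` and a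
fixed `d > c`, and evaluate `f` at `c + s` on the left. As `s → 0` the weight of `d` tends to `0`,
which bounds `f(c + s) - f(c - s)` by a quantity tending to `0`. -/
theorem OperatorMonotone.continuousAt {f : ℝ → ℝ} (hf : OperatorMonotone (Ioo (-1) 1) f)
    {c : ℝ} (hc : c ∈ Ioo (-1 : ℝ) 1) : ContinuousAt f c := by
  obtain ⟨hc1, hc2⟩ := hc
  set d := (c + 1) / 2 with hd
  -- `d` is the midpoint of `c` and `1`; the radius `r` below keeps `c - s > -1` and `c + 2s < d`
  -- for `s < r`.
  have hdm : d ∈ Ioo (-1 : ℝ) 1 := ⟨by linarith, by linarith⟩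
  set r := min ((c + 1) / 2) ((1 - c) / 4) with hr
  have hr0 : 0 < r := lt_min (by linarith) (by linarith)
  have hr1 : r ≤ (c + 1) / 2 := min_le_left _ _
  have hr2 : r ≤ (1 - c) / 4 := min_le_right _ _
  have hm := hf.monotoneOn
  let p : ℝ → ℝ := fun s => (d - (c + 2 * s)) / (d - (c - s))
  let q : ℝ → ℝ := fun s => 3 * s / (d - (c - s))
  let a : ℝ → ℝ := fun s => p s * (1 + (c - s)) / (1 + (c + 2 * s)) - 1
  let b : ℝ → ℝ := fun s => q s * ((1 + d) * f d) / (1 + (c + 2 * s))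
  set M := |f (c - r)| + |f c|
  have hdc : d - c ≠ 0 := by rw [hd]; intro h; linarith
  have hlim : Tendsto (fun s => M * |a s| + b s) (𝓝 0) (𝓝 0) := by
    have : ContinuousAt (fun s => M * |a s| + b s) 0 := by
      have h1 : d - (c - 0) ≠ 0 := by simpa using hdc
      have h2 : 1 + (c + 2 * 0) ≠ 0 := by intro h; linarith
      simp only [a, b, p, q]
      fun_prop (disch := assumption)
    have h0 : M * |a 0| + b 0 = 0 := by
      have h1 : 1 + c ≠ 0 := by intro h; linarith
      simp [a, b, p, q, div_self hdc, div_self h1]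
    simpa [ContinuousAt, h0] using this
  have hbound : ∀ s, 0 < s → s < r → f (c + s) - f (c - s) ≤ M * |a s| + b s := by
    intro s hs hsr
    have hD : 0 < d - (c - s) := by linarith
    have hy : 0 < 1 + (c + 2 * s) := by linarith
    have hcomb : p s * (c - s) + q s * d = c + 2 * s := by
      simp only [p, q]; field_simp; ring
    have key := hf.two_point (x := c - s) (y := d) (p := p s) (q := q s) (t := c + s)
      ⟨by linarith, by linarith⟩ hdm
      (div_nonneg (by linarith) hD.le) (div_nonneg (by linarith) hD.le)
      (by simp only [p, q]; field_simp; ring) (by linarith) (by rw [hcomb]; linarith)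
    rw [hcomb] at key
    have h1 : f (c + s) ≤ f (c - s) * (a s + 1) + b s := by
      have : f (c - s) * (a s + 1) + b s =
          (p s * ((1 + (c - s)) * f (c - s)) + q s * ((1 + d) * f d)) / (1 + (c + 2 * s)) := by
        simp only [a, b]; field_simp; ring
      rw [this, le_div_iff₀ hy]
      linarith
    have h2 : |f (c - s)| ≤ M := by
      have l1 : f (c - r) ≤ f (c - s) :=
        hm ⟨by linarith, by linarith⟩ ⟨by linarith, by linarith⟩ (by linarith)
      have l2 : f (c - s) ≤ f c :=
        hm ⟨by linarith, by linarith⟩ ⟨by linarith, by linarith⟩ (by linarith)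
      rw [abs_le]
      constructor
      · linarith [neg_abs_le (f (c - r)), abs_nonneg (f c)]
      · linarith [le_abs_self (f c), abs_nonneg (f (c - r))]
    have h3 : f (c - s) * a s ≤ M * |a s| := by
      calc f (c - s) * a s ≤ |f (c - s)| * |a s| := by
            rw [← abs_mul]; exact le_abs_self _
        _ ≤ M * |a s| := mul_le_mul_of_nonneg_right h2 (abs_nonneg _)
    linarith
  rw [continuousAt_iff_punctured_nhds, tendsto_iff_dist_tendsto_zero]
  have habs : Tendsto (fun x => |x - c|) (𝓝[≠] c) (𝓝 0) := by
    have : Tendsto (fun x => |x - c|) (𝓝 c) (𝓝 |c - c|) :=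
      Continuous.tendsto (by fun_prop) c
    rw [sub_self, abs_zero] at this
    exact this.mono_left nhdsWithin_le_nhds
  refine squeeze_zero' (Eventually.of_forall fun _ => dist_nonneg) ?_ (hlim.comp habs)
  filter_upwards [habs.eventually (gt_mem_nhds hr0), self_mem_nhdsWithin] with x hx hne
  have hpos : 0 < |x - c| := abs_pos.2 (sub_ne_zero.2 hne)
  refine le_trans ?_ (hbound _ hpos hx)
  have hle := abs_le.1 (le_refl |x - c|)
  have m1 : f (c - |x - c|) ≤ f x :=
    hm ⟨by linarith, by linarith⟩ ⟨by linarith, by linarith⟩ (by linarith)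
  have m2 : f x ≤ f (c + |x - c|) :=
    hm ⟨by linarith, by linarith⟩ ⟨by linarith, by linarith⟩ (by linarith)
  have m3 : f (c - |x - c|) ≤ f c :=
    hm ⟨by linarith, by linarith⟩ ⟨by linarith, by linarith⟩ (by linarith)
  have m4 : f c ≤ f (c + |x - c|) :=
    hm ⟨by linarith, by linarith⟩ ⟨by linarith, by linarith⟩ (by linarith)
  rw [Real.dist_eq, abs_le]
  constructor <;> linarith

/-- Continuity allows the slack to tend to `0`. -/
theorem OperatorMonotone.operatorJensen_one_add_mul {f : ℝ → ℝ}
    (hf : OperatorMonotone (Ioo (-1) 1) f) : OperatorJensen fun t => (1 + t) * f t := by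
  refine ⟨fun {ι κ} _ _ _ _ {Z V} hZ hV => ?_⟩
  have hev : ∀ᶠ δ in 𝓝[>] (0 : ℝ), δ ∈ Ioo (0 : ℝ) 1 := Ioo_mem_nhdsGT one_pos
  refine matrix_le_of_tendsto (l := 𝓝[>] (0 : ℝ)) (tendsto_cfc_of_tendsto ?_) tendsto_const_nhds
    (hev.mono fun δ hδ => hf.one_add_mul_conj_le hZ hV hδ.1 hδ.2)
  intro t ht
  refine Tendsto.const_mul _ ?_
  have hc := hf.continuousAt ((hZ.conj hV).subset ht)
  have h1 : Tendsto (fun δ : ℝ => (1 - δ) * (1 + t) - 1) (𝓝[>] 0) (𝓝 t) := by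
    have : Tendsto (fun δ : ℝ => (1 - δ) * (1 + t) - 1) (𝓝 0) (𝓝 ((1 - 0) * (1 + t) - 1)) :=
      Continuous.tendsto (by fun_prop) 0
    have e : (1 - 0) * (1 + t) - 1 = t := by ring
    rw [e] at this
    exact this.mono_left nhdsWithin_le_nhds
  exact hc.tendsto.comp h1

theorem UnitSpectrum.neg {A : Matrix ι ι ℂ} (h : UnitSpectrum A) : UnitSpectrum (-A) :=
  ⟨by simpa [sub_eq_add_neg] using h.2, by simpa using h.1⟩

theorem cfc_comp_neg_fun (f : ℝ → ℝ) {A : Matrix ι ι ℂ} (hA : A.IsHermitian) :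
    cfc (fun t => f (-t)) A = cfc f (-A) :=
  cfc_comp_neg f A ((A.finite_real_spectrum.image _).continuousOn f) hA

theorem OperatorMonotone.of_cfc_le {f : ℝ → ℝ}
    (h : ∀ (n : ℕ) (A B : Matrix (Fin n) (Fin n) ℂ), UnitSpectrum A → UnitSpectrum B → A ≤ B →
      cfc f A ≤ cfc f B) : OperatorMonotone (Ioo (-1) 1) f := fun n A B hA hB sA sB hAB =>
  Matrix.le_iff.1 (h n A B ((unitSpectrum_iff hA).1 sA) ((unitSpectrum_iff hB).1 sB)
    (Matrix.le_iff.2 hAB))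

theorem OperatorMonotone.reflect {f : ℝ → ℝ} (hf : OperatorMonotone (Ioo (-1) 1) f) :
    OperatorMonotone (Ioo (-1) 1) fun t => -f (-t) := by
  refine .of_cfc_le fun n A B hA hB hAB => ?_
  rw [cfc_neg, cfc_neg, cfc_comp_neg_fun f hA.isHermitian, cfc_comp_neg_fun f hB.isHermitian,
    neg_le_neg_iff]
  exact hf.cfc_le hB.neg hA.neg (neg_le_neg hAB)

theorem OperatorJensen.reflect {F : ℝ → ℝ} (hF : OperatorJensen F) :
    OperatorJensen fun t => F (-t) := by
  refine ⟨fun {ι κ} _ _ _ _ {Z V} hZ hV => ?_⟩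
  rw [cfc_comp_neg_fun F hZ.isHermitian, cfc_comp_neg_fun F (hZ.conj hV).isHermitian]
  have := hF.conj_le hZ.neg hV
  rwa [Matrix.mul_neg, Matrix.neg_mul] at this

/-- Apply the previous inequality to the operator monotone function `-f(-t)` and reflect back. -/
theorem OperatorMonotone.operatorJensen_sub_one_mul {f : ℝ → ℝ}
    (hf : OperatorMonotone (Ioo (-1) 1) f) : OperatorJensen fun t => (t - 1) * f t := by
  have := hf.reflect.operatorJensen_one_add_mul.reflect
  have e : (fun t : ℝ => (1 + -t) * -f (- -t)) = fun t => (t - 1) * f t := by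
    funext t
    rw [neg_neg]
    ring
  rwa [e] at this

/-- Convexity of `(1 + t) f` gives one-sided derivatives of `f` with left ≤ right. Convexity of `(t
- 1) f` gives the opposite inequality, because `t - 1` is negative. -/
theorem OperatorMonotone.differentiableAt {f : ℝ → ℝ} (hf : OperatorMonotone (Ioo (-1) 1) f)
    {c : ℝ} (hc : c ∈ Ioo (-1 : ℝ) 1) : DifferentiableAt ℝ f c := by
  have hint : c ∈ interior (Ioo (-1 : ℝ) 1) := by rwa [interior_Ioo]
  have hF := hf.operatorJensen_one_add_mul.convexOn
  have hH := hf.operatorJensen_sub_one_mul.convexOn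
  have hc1 : 1 + c ≠ 0 := by linarith [hc.1]
  have transfer : ∀ (s : Set ℝ) (x : ℝ), HasDerivWithinAt (fun t => (1 + t) * f t) x s c →
      HasDerivWithinAt f ((x - f c) / (1 + c)) s c := by
    intro s x hx
    have h1 : HasDerivWithinAt (fun t : ℝ => (1 + t)⁻¹) (-1 / (1 + c) ^ 2) s c :=
      (((hasDerivAt_id c).const_add 1).inv hc1).hasDerivWithinAt
    have h2 := h1.mul hx
    have hx1 : f c = (1 + c)⁻¹ * ((1 + c) * f c) := by rw [inv_mul_cancel_left₀ hc1]
    have h3 : (fun t => f t) =ᶠ[𝓝[s] c] fun t => (1 + t)⁻¹ * ((1 + t) * f t) := by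
      refine Filter.Eventually.filter_mono nhdsWithin_le_nhds ?_
      filter_upwards [lt_mem_nhds hc.1] with t ht
      rw [inv_mul_cancel_left₀]
      intro h; linarith
    refine (h2.congr_of_eventuallyEq h3 hx1).congr_deriv ?_
    field_simp
    ring
  have hr := transfer _ _ (hF.hasDerivWithinAt_rightDeriv_of_mem_interior hint)
  have hl := transfer _ _ (hF.hasDerivWithinAt_leftDeriv_of_mem_interior hint)
  have hlr := hF.leftDeriv_le_rightDeriv_of_mem_interior hint
  set R := (derivWithin (fun t => (1 + t) * f t) (Ioi c) c - f c) / (1 + c)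
  set L := (derivWithin (fun t => (1 + t) * f t) (Iio c) c - f c) / (1 + c)
  have hLR : L ≤ R := div_le_div_of_nonneg_right (by linarith) (by linarith [hc.1])
  have hlin : ∀ s : Set ℝ, HasDerivWithinAt (fun t : ℝ => t - 1) 1 s c := fun s =>
    ((hasDerivAt_id c).sub_const 1).hasDerivWithinAt
  have hHr := ((hlin (Ioi c)).mul hr).derivWithin (uniqueDiffWithinAt_Ioi c)
  have hHl := ((hlin (Iio c)).mul hl).derivWithin (uniqueDiffWithinAt_Iio c)
  have hlr' := hH.leftDeriv_le_rightDeriv_of_mem_interior hint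
  have hRL : R ≤ L := by
    have h : (1 : ℝ) * f c + (c - 1) * L ≤ 1 * f c + (c - 1) * R := by
      rw [← hHl, ← hHr]; exact hlr'
    nlinarith [hc.2]
  have hEq : L = R := le_antisymm hLR hRL
  rw [hEq] at hl
  have hu := hl.Iic_of_Iio.union hr.Ici_of_Ioi
  rw [Iic_union_Ici] at hu
  exact (hasDerivWithinAt_univ.1 hu).differentiableAt

end Scalar

/-! ### From isometries to contractions. -/

section Contraction

variable {ι κ : Type} [Fintype ι] [DecidableEq ι] [Fintype κ] [DecidableEq κ]

theorem posDef_fromBlocks {A : Matrix ι ι ℂ} {D : Matrix κ κ ℂ} (hA : A.PosDef) (hD : D.PosDef) :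
    (fromBlocks A 0 0 D).PosDef := by
  have hPSD : (fromBlocks A 0 0 D).PosSemidef := by
    have := hA.isUnit.invertible
    have := (PosDef.fromBlocks₁₁ (0 : Matrix ι κ ℂ) D hA).2 (by simpa using hD.posSemidef)
    simpa using this
  rw [hPSD.posDef_iff_det_ne_zero, det_fromBlocks_zero₂₁]
  exact mul_ne_zero hA.det_pos.ne' hD.det_pos.ne'

theorem UnitSpectrum.fromBlocks {A : Matrix ι ι ℂ} {D : Matrix κ κ ℂ} (hA : UnitSpectrum A)
    (hD : UnitSpectrum D) : UnitSpectrum (fromBlocks A 0 0 D) := by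
  constructor
  · rw [← fromBlocks_one, fromBlocks_add]
    simpa using posDef_fromBlocks hA.1 hD.1
  · rw [sub_eq_add_neg, ← fromBlocks_one, fromBlocks_neg, fromBlocks_add]
    simpa [sub_eq_add_neg] using posDef_fromBlocks hA.2 hD.2

theorem unitSpectrum_zero : UnitSpectrum (0 : Matrix ι ι ℂ) :=
  ⟨by simpa using PosDef.one, by simpa using PosDef.one⟩

theorem cfc_fromBlocks (f : ℝ → ℝ) {A : Matrix ι ι ℂ} {D : Matrix κ κ ℂ} (hA : A.IsHermitian)
    (hD : D.IsHermitian) : cfc f (fromBlocks A 0 0 D) = fromBlocks (cfc f A) 0 0 (cfc f D) := by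
  have hM : (fromBlocks A 0 0 D).IsHermitian := hA.fromBlocks (by simp) hD
  have h1 := cfc_intertwine f hM hA (C := fromRows 1 0) (by
    rw [fromBlocks_mul_fromRows, fromRows_mul]; simp)
  have h2 := cfc_intertwine f hM hD (C := fromRows 0 1) (by
    rw [fromBlocks_mul_fromRows, fromRows_mul]; simp)
  have e : fromCols (fromRows (1 : Matrix ι ι ℂ) (0 : Matrix κ ι ℂ))
      (fromRows (0 : Matrix ι κ ℂ) (1 : Matrix κ κ ℂ)) = 1 := by
    rw [fromCols_fromRows_eq_fromBlocks, fromBlocks_one]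
  have h3 : cfc f (fromBlocks A 0 0 D) * fromCols (fromRows (1 : Matrix ι ι ℂ) (0 : Matrix κ ι ℂ))
      (fromRows (0 : Matrix ι κ ℂ) (1 : Matrix κ κ ℂ)) = fromBlocks (cfc f A) 0 0 (cfc f D) := by
    rw [mul_fromCols, h1, h2, fromRows_mul, fromRows_mul, fromCols_fromRows_eq_fromBlocks]
    simp
  rwa [e, Matrix.mul_one] at h3

theorem cfc_zero_matrix {f : ℝ → ℝ} (hf : f 0 = 0) : cfc f (0 : Matrix ι ι ℂ) = 0 := by
  have := cfc_apply_zero (R := ℝ) (A := Matrix ι ι ℂ) (f := f)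
  rw [this, hf, map_zero]

/-- Dilate `V` to the isometry with rows `V` and `(1 - VᴴV)^(1/2)`, and `Z` to `Z ⊕ 0`. The added
block contributes nothing because `F 0 = 0`. -/
theorem OperatorJensen.conj_le_of_contraction {F : ℝ → ℝ} (hF : OperatorJensen F) (hF0 : F 0 = 0)
    {Z : Matrix κ κ ℂ} {V : Matrix κ ι ℂ} (hZ : UnitSpectrum Z) (hV : Vᴴ * V ≤ 1) :
    cfc F (Vᴴ * Z * V) ≤ Vᴴ * cfc F Z * V := by
  have hs : (CFC.sqrt (1 - Vᴴ * V)) * (CFC.sqrt (1 - Vᴴ * V)) = 1 - Vᴴ * V :=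
    CFC.sqrt_mul_sqrt_self _ (sub_nonneg.2 hV)
  have hR : (CFC.sqrt (1 - Vᴴ * V))ᴴ = CFC.sqrt (1 - Vᴴ * V) :=
    (CFC.sqrt_nonneg (1 - Vᴴ * V)).posSemidef.isHermitian
  set R := CFC.sqrt (1 - Vᴴ * V)
  have hW : (fromRows V R)ᴴ * fromRows V R = 1 := by
    rw [conjTranspose_fromRows_eq_fromCols_conjTranspose, fromCols_mul_fromRows, hR, hs]
    abel
  have hconj : ∀ X : Matrix κ κ ℂ, (fromRows V R)ᴴ * fromBlocks X 0 0 (0 : Matrix ι ι ℂ) *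
      fromRows V R = Vᴴ * X * V := by
    intro X
    rw [conjTranspose_fromRows_eq_fromCols_conjTranspose, fromCols_mul_fromBlocks,
      fromCols_mul_fromRows]
    simp
  have := hF.conj_le (hZ.fromBlocks (unitSpectrum_zero (ι := ι))) hW
  rwa [cfc_fromBlocks F hZ.isHermitian isHermitian_zero, cfc_zero_matrix hF0, hconj, hconj] at this

end Contraction

/-! ### Positive part of one matrix, negative part of another. -/

section Kraus

variable {ι : Type} [Fintype ι] [DecidableEq ι]

/-- `g` on positive reals, `0` elsewhere. -/
noncomputable def onPos (g : ℝ → ℝ) (t : ℝ) : ℝ := if 0 < t then g t else 0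

/-- `g` on negative reals, `0` elsewhere. -/
noncomputable def onNeg (g : ℝ → ℝ) (t : ℝ) : ℝ := if t < 0 then g t else 0

theorem onPos_mul (g h : ℝ → ℝ) : (fun t => onPos g t * onPos h t) = onPos fun t => g t * h t := by
  funext t; simp only [onPos]; split_ifs <;> simp

theorem onNeg_mul (g h : ℝ → ℝ) : (fun t => onNeg g t * onNeg h t) = onNeg fun t => g t * h t := by
  funext t; simp only [onNeg]; split_ifs <;> simp

theorem onPos_congr {g h : ℝ → ℝ} (H : ∀ t, 0 < t → g t = h t) : onPos g = onPos h := by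
  funext t; simp only [onPos]; split_ifs with ht; exacts [H t ht, rfl]

theorem onNeg_congr {g h : ℝ → ℝ} (H : ∀ t, t < 0 → g t = h t) : onNeg g = onNeg h := by
  funext t; simp only [onNeg]; split_ifs with ht; exacts [H t ht, rfl]

theorem cfc_onPos_mul (g h : ℝ → ℝ) (A : Matrix ι ι ℂ) :
    cfc (onPos g) A * cfc (onPos h) A = cfc (onPos fun t => g t * h t) A := by
  rw [← cfc_mul_fun, onPos_mul]

theorem cfc_onNeg_mul (g h : ℝ → ℝ) (A : Matrix ι ι ℂ) :
    cfc (onNeg g) A * cfc (onNeg h) A = cfc (onNeg fun t => g t * h t) A := by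
  rw [← cfc_mul_fun, onNeg_mul]

theorem cfc_eq_onPos_add_onNeg (g : ℝ → ℝ) {A : Matrix ι ι ℂ} (hA : (0 : ℝ) ∉ spectrum ℝ A) :
    cfc g A = cfc (onPos g) A + cfc (onNeg g) A := by
  rw [← cfc_add_fun]
  refine cfc_congr fun t ht => ?_
  have h0 : t ≠ 0 := fun h => hA (h ▸ ht)
  rcases lt_or_gt_of_ne h0 with h | h
  · simp [onPos, onNeg, h, h.le]
  · simp [onPos, onNeg, h, h.le]

/-- The block sum of `g(A)` on the positive part of `A` and `g(B)` on the negative part of `B`. -/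
noncomputable def signBlock (g : ℝ → ℝ) (A B : Matrix ι ι ℂ) : Matrix (ι ⊕ ι) (ι ⊕ ι) ℂ :=
  fromBlocks (cfc (onPos g) A) 0 0 (cfc (onNeg g) B)

/-- The map sending `v` to its components in the positive part of `A` and negative part of `B`. -/
noncomputable def signRows (A B : Matrix ι ι ℂ) : Matrix (ι ⊕ ι) ι ℂ :=
  fromRows (cfc (onPos fun _ => 1) A) (cfc (onNeg fun _ => 1) B)

/-- The sum of `g(A)` on the positive part of `A` and `g(B)` on the negative part of `B`. -/
noncomputable def signSum (g : ℝ → ℝ) (A B : Matrix ι ι ℂ) : Matrix ι ι ℂ :=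
  cfc (onPos g) A + cfc (onNeg g) B

theorem signBlock_mul (g h : ℝ → ℝ) (A B : Matrix ι ι ℂ) :
    signBlock g A B * signBlock h A B = signBlock (fun t => g t * h t) A B := by
  simp [signBlock, fromBlocks_multiply, cfc_onPos_mul, cfc_onNeg_mul]

theorem signBlock_congr {g h : ℝ → ℝ} (H : ∀ t, t ≠ 0 → g t = h t) (A B : Matrix ι ι ℂ) :
    signBlock g A B = signBlock h A B := by
  rw [signBlock, signBlock, onPos_congr fun t ht => H t ht.ne', onNeg_congr fun t ht => H t ht.ne]

theorem signSum_congr {g h : ℝ → ℝ} (H : ∀ t, t ≠ 0 → g t = h t) (A B : Matrix ι ι ℂ) :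
    signSum g A B = signSum h A B := by
  rw [signSum, signSum, onPos_congr fun t ht => H t ht.ne', onNeg_congr fun t ht => H t ht.ne]

theorem signBlock_conjTranspose (g : ℝ → ℝ) (A B : Matrix ι ι ℂ) :
    (signBlock g A B)ᴴ = signBlock g A B := by
  rw [signBlock, fromBlocks_conjTranspose, (cfc_isHermitian (onPos g) A).eq,
    (cfc_isHermitian (onNeg g) B).eq]
  simp

theorem signRows_conj (g : ℝ → ℝ) (A B : Matrix ι ι ℂ) :
    (signRows A B)ᴴ * signBlock g A B * signRows A B = signSum g A B := by
  rw [signRows, signBlock, conjTranspose_fromRows_eq_fromCols_conjTranspose,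
    fromCols_mul_fromBlocks, fromCols_mul_fromRows, (cfc_isHermitian (onPos _) A).eq,
    (cfc_isHermitian (onNeg _) B).eq]
  simp [cfc_onPos_mul, cfc_onNeg_mul, signSum]

theorem signBlock_one_mul_signRows (A B : Matrix ι ι ℂ) :
    signBlock (fun _ => 1) A B * signRows A B = signRows A B := by
  rw [signRows, signBlock, fromBlocks_mul_fromRows]
  simp [cfc_onPos_mul, cfc_onNeg_mul]

theorem signRows_gram (A B : Matrix ι ι ℂ) :
    (signRows A B)ᴴ * signRows A B = signSum (fun _ => 1) A B := by
  rw [← signRows_conj, Matrix.mul_assoc, signBlock_one_mul_signRows]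

theorem trace_signBlock_one (A B : Matrix ι ι ℂ) :
    (signBlock (fun _ => 1) A B).trace = (signSum (fun _ => 1) A B).trace := by
  rw [signBlock, signSum, trace_add]
  simp [Matrix.trace, Fintype.sum_sum_type]

theorem signBlock_one_le (A B : Matrix ι ι ℂ) : signBlock (fun _ => 1) A B ≤ 1 := by
  rw [Matrix.le_iff]
  set P := signBlock (fun _ => 1) A B with hP
  have hPH : Pᴴ = P := signBlock_conjTranspose _ _ _
  have hPP : P * P = P := by rw [hP, signBlock_mul]; simp
  have : 1 - P = (1 - P)ᴴ * (1 - P) := by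
    rw [conjTranspose_sub, hPH, conjTranspose_one, Matrix.mul_sub, Matrix.sub_mul, Matrix.sub_mul,
      hPP]
    simp
  rw [this]
  exact posSemidef_conjTranspose_mul_self _

theorem cfc_signBlock_id {F : ℝ → ℝ} (hF : F 0 = 0) {A B : Matrix ι ι ℂ} (hA : A.IsHermitian)
    (hB : B.IsHermitian) : cfc F (signBlock (fun t => t) A B) = signBlock F A B := by
  rw [signBlock, cfc_fromBlocks F (cfc_isHermitian _ _) (cfc_isHermitian _ _),
    ← cfc_comp_fun F _ hA, ← cfc_comp_fun F _ hB, signBlock]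
  congr 2
  · funext t; simp only [onPos]; split_ifs; exacts [rfl, hF]
  · funext t; simp only [onNeg]; split_ifs; exacts [rfl, hF]

theorem unitSpectrum_cfc {A : Matrix ι ι ℂ} (hA : A.IsHermitian) {g : ℝ → ℝ}
    (hg : ∀ t ∈ spectrum ℝ A, g t ∈ Ioo (-1 : ℝ) 1) : UnitSpectrum (cfc g A) := by
  rw [← unitSpectrum_iff (cfc_isHermitian g A),
    cfc_map_spectrum g A hA.isSelfAdjoint (continuousOn_spectrum _ _)]
  rintro _ ⟨t, ht, rfl⟩
  exact hg t ht

theorem unitSpectrum_signBlock_id {A B : Matrix ι ι ℂ} (hA : UnitSpectrum A)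
    (hB : UnitSpectrum B) : UnitSpectrum (signBlock (fun t => t) A B) := by
  refine UnitSpectrum.fromBlocks (unitSpectrum_cfc hA.isHermitian fun t ht => ?_)
    (unitSpectrum_cfc hB.isHermitian fun t ht => ?_)
  · simp only [onPos]; split_ifs
    exacts [hA.subset ht, by norm_num]
  · simp only [onNeg]; split_ifs
    exacts [hB.subset ht, by norm_num]

/-- A kernel vector has no component in the positive part of `X` or the negative part of `W`. Its
quadratic form is then `≥ 0` for `h(W)` and `≤ 0` for `h(X)`, so `h(W) ≤ h(X)` forces both to
vanish. Hence its component in the negative part of `X` vanishes too. -/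
theorem isUnit_signSum_one {h : ℝ → ℝ} (hpos : ∀ t, 0 < t → 0 < h t) (hneg : ∀ t, t < 0 → h t < 0)
    {X W : Matrix ι ι ℂ} (hX : X.IsHermitian) (hX0 : (0 : ℝ) ∉ spectrum ℝ X)
    (hW0 : (0 : ℝ) ∉ spectrum ℝ W) (hle : cfc h W ≤ cfc h X) :
    IsUnit (signSum (fun _ => 1) X W) := by
  have p1 : (cfc (onPos fun _ => 1) X).PosSemidef := (cfc_nonneg_fun fun t _ => by
    simp only [onPos]; split_ifs <;> norm_num).posSemidef
  have p2 : (cfc (onNeg fun _ => 1) W).PosSemidef := (cfc_nonneg_fun fun t _ => by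
    simp only [onNeg]; split_ifs <;> norm_num).posSemidef
  have p3 : (cfc (onPos h) W).PosSemidef := (cfc_nonneg_fun fun t _ => by
    simp only [onPos]; split_ifs with ht; exacts [(hpos t ht).le, le_rfl]).posSemidef
  have p4 : (cfc (onNeg fun t => -h t) X).PosSemidef := (cfc_nonneg_fun fun t _ => by
    simp only [onNeg]; split_ifs with ht; exacts [by linarith [hneg t ht], le_rfl]).posSemidef
  have hG : (signSum (fun _ => 1) X W).PosSemidef := p1.add p2
  refine (PosDef.of_dotProduct_mulVec_pos hG.isHermitian fun x hx =>
      lt_of_le_of_ne (hG.dotProduct_mulVec_nonneg x) fun h0 => hx ?_).isUnit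
  rw [signSum, Matrix.add_mulVec, dotProduct_add] at h0
  have z := (add_eq_zero_iff_of_nonneg (p1.dotProduct_mulVec_nonneg x)
    (p2.dotProduct_mulVec_nonneg x)).1 h0.symm
  have z1 := (p1.dotProduct_mulVec_zero_iff x).1 z.1
  have z2 := (p2.dotProduct_mulVec_zero_iff x).1 z.2
  have e1 : cfc (onPos h) X *ᵥ x = 0 := by
    have : cfc (onPos h) X = cfc (onPos h) X * cfc (onPos fun _ => 1) X := by
      rw [cfc_onPos_mul]; simp
    rw [this, ← mulVec_mulVec, z1, mulVec_zero]
  have e2 : cfc (onNeg h) W *ᵥ x = 0 := by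
    have : cfc (onNeg h) W = cfc (onNeg h) W * cfc (onNeg fun _ => 1) W := by
      rw [cfc_onNeg_mul]; simp
    rw [this, ← mulVec_mulVec, z2, mulVec_zero]
  have e3 : cfc (onNeg h) X = -cfc (onNeg fun t => -h t) X := by
    rw [← cfc_neg]
    congr 1
    funext t
    simp only [onNeg]
    split_ifs <;> simp
  have key := (Matrix.le_iff.1 hle).dotProduct_mulVec_nonneg x
  rw [cfc_eq_onPos_add_onNeg h hX0, cfc_eq_onPos_add_onNeg h hW0, Matrix.sub_mulVec,
    Matrix.add_mulVec, Matrix.add_mulVec, e1, e2, e3, Matrix.neg_mulVec, zero_add, add_zero,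
    dotProduct_sub, dotProduct_neg] at key
  have n3 := p3.dotProduct_mulVec_nonneg x
  have n4 := p4.dotProduct_mulVec_nonneg x
  have z4 : star x ⬝ᵥ cfc (onNeg fun t => -h t) X *ᵥ x = 0 := by
    refine le_antisymm ?_ n4
    have := add_le_add key n3
    simpa [sub_add_cancel] using this
  have z5 := (p4.dotProduct_mulVec_zero_iff x).1 z4
  have e5 : cfc (onNeg fun _ => 1) X *ᵥ x = 0 := by
    have : cfc (onNeg fun _ => 1) X =
        cfc (onNeg fun t => (-h t)⁻¹) X * cfc (onNeg fun t => -h t) X := by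
      rw [cfc_onNeg_mul, onNeg_congr]
      intro t ht
      rw [inv_mul_cancel₀]
      linarith [hneg t ht]
    rw [this, ← mulVec_mulVec, z5, mulVec_zero]
  have e6 : (1 : Matrix ι ι ℂ) = cfc (onPos fun _ => 1) X + cfc (onNeg fun _ => 1) X := by
    rw [← cfc_eq_onPos_add_onNeg _ hX0, cfc_const_one ℝ X hX.isSelfAdjoint]
  calc x = (1 : Matrix ι ι ℂ) *ᵥ x := (one_mulVec x).symm
    _ = 0 := by rw [e6, Matrix.add_mulVec, z1, e5, add_zero]

/-- `V G⁻¹ Vᴴ` is the orthogonal projection onto the range of `V = signRows A B`, which lies in the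
range of the projection `signBlock 1 A B`. Its rank is the size of the matrices because `G = VᴴV` is
invertible. -/
theorem posSemidef_signBlock_sub {A B : Matrix ι ι ℂ} (hG : IsUnit (signSum (fun _ => 1) A B)) :
    (signBlock (fun _ => 1) A B -
      signRows A B * (signSum (fun _ => 1) A B)⁻¹ * (signRows A B)ᴴ).PosSemidef ∧
    (signRows A B * (signSum (fun _ => 1) A B)⁻¹ * (signRows A B)ᴴ).trace = Fintype.card ι := by
  set V := signRows A B with hV
  set P := signBlock (fun _ => 1) A B with hP
  have hPV : P * V = V := signBlock_one_mul_signRows A B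
  have hPH : Pᴴ = P := signBlock_conjTranspose _ _ _
  have hVP : Vᴴ * P = Vᴴ := by
    have := congrArg conjTranspose hPV
    rwa [conjTranspose_mul, hPH] at this
  have hPP : P * P = P := by rw [hP, signBlock_mul]; simp
  have hVV : Vᴴ * V = signSum (fun _ => 1) A B := signRows_gram A B
  set G := signSum (fun _ => 1) A B
  have hGG : G⁻¹ * G = 1 := Matrix.nonsing_inv_mul _ ((Matrix.isUnit_iff_isUnit_det _).1 hG)
  have hGH : G⁻¹ᴴ = G⁻¹ := by
    rw [conjTranspose_nonsing_inv, ← hVV, conjTranspose_mul, conjTranspose_conjTranspose]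
  set Q := V * G⁻¹ * Vᴴ with hQ
  have hQH : Qᴴ = Q := by
    rw [hQ, conjTranspose_mul, conjTranspose_mul, conjTranspose_conjTranspose, hGH,
      Matrix.mul_assoc]
  have hQV : Q * V = V := by
    rw [hQ, Matrix.mul_assoc, Matrix.mul_assoc, hVV, hGG, Matrix.mul_one]
  have hQQ : Q * Q = Q := by
    nth_rewrite 2 [hQ]
    rw [← Matrix.mul_assoc, ← Matrix.mul_assoc, hQV]
  have hPQ : P * Q = Q := by rw [hQ, ← Matrix.mul_assoc, ← Matrix.mul_assoc, hPV]
  have hQP : Q * P = Q := by rw [hQ, Matrix.mul_assoc, hVP]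
  constructor
  · have : P - Q = (P - Q)ᴴ * (P - Q) := by
      rw [conjTranspose_sub, hPH, hQH, Matrix.mul_sub, Matrix.sub_mul, Matrix.sub_mul, hPP, hPQ,
        hQP, hQQ]
      simp
    rw [this]
    exact posSemidef_conjTranspose_mul_self _
  · rw [hQ, Matrix.mul_assoc, trace_mul_comm, Matrix.mul_assoc, hVV, hGG, trace_one]

/-- For `A ≤ B` with `B⁻¹ ≤ A⁻¹` the range of `signRows A B` is the full support of
`signBlock · A B`. -/
theorem signRows_mul_inv_mul {A B : Matrix ι ι ℂ} (hA : A.IsHermitian) (hB : B.IsHermitian)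
    (hA0 : (0 : ℝ) ∉ spectrum ℝ A) (hB0 : (0 : ℝ) ∉ spectrum ℝ B) (hAB : A ≤ B)
    (hinv : cfc (fun t : ℝ => t⁻¹) B ≤ cfc (fun t : ℝ => t⁻¹) A) :
    IsUnit (signSum (fun _ => 1) A B) ∧
    signRows A B * (signSum (fun _ => 1) A B)⁻¹ * (signRows A B)ᴴ = signBlock (fun _ => 1) A B := by
  have u1 : IsUnit (signSum (fun _ => 1) A B) :=
    isUnit_signSum_one (fun t ht => inv_pos.2 ht) (fun t ht => inv_lt_zero.2 ht) hA hA0 hB0 hinv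
  have u2 : IsUnit (signSum (fun _ => 1) B A) :=
    isUnit_signSum_one (h := fun t => t) (fun t ht => ht) (fun t ht => ht) hB hB0 hA0 (by
      rwa [cfc_id' ℝ A hA.isSelfAdjoint, cfc_id' ℝ B hB.isSelfAdjoint])
  obtain ⟨s1, t1⟩ := posSemidef_signBlock_sub u1
  obtain ⟨s2, t2⟩ := posSemidef_signBlock_sub u2
  refine ⟨u1, ?_⟩
  -- Dimension count: the traces of the two block projections add up to twice the matrix size, and
  -- each is at least the size. Both are therefore equalities, and a positive semidefinite
  -- difference of trace zero vanishes.
  have n1 := s1.trace_nonneg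
  have n2 := s2.trace_nonneg
  have hone : signSum (fun _ => 1) A B + signSum (fun _ => 1) B A = 2 := by
    have eA := cfc_eq_onPos_add_onNeg (fun _ => 1) hA0
    have eB := cfc_eq_onPos_add_onNeg (fun _ => 1) hB0
    rw [cfc_const_one ℝ A hA.isSelfAdjoint] at eA
    rw [cfc_const_one ℝ B hB.isSelfAdjoint] at eB
    rw [signSum, signSum, ← one_add_one_eq_two]
    nth_rewrite 1 [eA]
    rw [eB]
    abel
  have htr : (signSum (fun _ => 1) A B).trace + (signSum (fun _ => 1) B A).trace =
      2 * (Fintype.card ι : ℂ) := by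
    rw [← trace_add, hone, ← one_add_one_eq_two, trace_add, trace_one]
    ring
  rw [trace_sub, trace_signBlock_one, t1] at n1
  rw [trace_sub, trace_signBlock_one, t2] at n2
  have hz : (signBlock (fun _ => 1) A B -
      signRows A B * (signSum (fun _ => 1) A B)⁻¹ * (signRows A B)ᴴ).trace = 0 := by
    rw [trace_sub, trace_signBlock_one, t1]
    refine le_antisymm ?_ n1
    have e : (signSum (fun _ => 1) A B).trace - (Fintype.card ι : ℂ) =
        -((signSum (fun _ => 1) B A).trace - Fintype.card ι) := by linear_combination htr
    rw [e]
    exact neg_nonpos.2 n2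
  exact (sub_eq_zero.1 (s1.trace_eq_zero_iff.1 hz)).symm

end Kraus

/-! ### Jensen implies monotonicity of `F(t) / t` when inverses are ordered. -/

section Kraus

variable {ι : Type} [Fintype ι] [DecidableEq ι]

/-- This trades an inequality between `h(A)` and `h(B)` for one between sums in which the negative
parts have changed sides. With `h(t) = F(t) / t` the weight becomes `F(t) / |t|`, whose denominator
is positive. -/
theorem signSum_sub {k h : ℝ → ℝ} (hp : ∀ t, 0 < t → k t = h t) (hn : ∀ t, t < 0 → k t = -h t)
    {A B : Matrix ι ι ℂ} (hA0 : (0 : ℝ) ∉ spectrum ℝ A) (hB0 : (0 : ℝ) ∉ spectrum ℝ B) :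
    signSum k A B - signSum k B A = cfc h A - cfc h B := by
  have e : onNeg k = fun t => -onNeg h t := by
    funext t
    simp only [onNeg]
    split_ifs with ht
    exacts [hn t ht, neg_zero.symm]
  rw [signSum, signSum, onPos_congr hp, e, cfc_neg, cfc_neg, cfc_eq_onPos_add_onNeg h hA0,
    cfc_eq_onPos_add_onNeg h hB0]
  abel

/-- Put `Y = A₊ ⊕ B₋` and `Z = B₊ ⊕ A₋`. A contraction `K` with `KᴴZK = Y` gives `F(Y) ≤ KᴴF(Z)K`.
Compressing by `|Y|^(-1/2) U` turns this into a comparison of sums weighted by `F(t) / |t|`, which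
rearranges to the claim. -/
theorem OperatorJensen.cfc_div_le_of_inv_le {F : ℝ → ℝ} (hF : OperatorJensen F) (hF0 : F 0 = 0)
    {A B : Matrix ι ι ℂ} (hA : UnitSpectrum A) (hB : UnitSpectrum B)
    (hA0 : (0 : ℝ) ∉ spectrum ℝ A) (hB0 : (0 : ℝ) ∉ spectrum ℝ B) (hAB : A ≤ B)
    (hinv : cfc (fun t : ℝ => t⁻¹) B ≤ cfc (fun t : ℝ => t⁻¹) A) :
    cfc (fun t => F t / t) A ≤ cfc (fun t => F t / t) B := by
  obtain ⟨hu, hE⟩ := signRows_mul_inv_mul hA.isHermitian hB.isHermitian hA0 hB0 hAB hinv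
  have hGG : (signSum (fun _ => 1) A B)⁻¹ * signSum (fun _ => 1) A B = 1 :=
    Matrix.nonsing_inv_mul _ ((Matrix.isUnit_iff_isUnit_det _).1 hu)
  have hGH : (signSum (fun _ => 1) A B)⁻¹ᴴ = (signSum (fun _ => 1) A B)⁻¹ := by
    rw [conjTranspose_nonsing_inv, ← signRows_gram, conjTranspose_mul, conjTranspose_conjTranspose]
  set Gi := (signSum (fun _ => 1) A B)⁻¹
  set U := signRows A B with hU
  set W := signRows B A with hW
  set r : ℝ → ℝ := fun t => √|t| with hr
  set ri : ℝ → ℝ := fun t => (√|t|)⁻¹ with hri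
  have hr0 : ∀ t : ℝ, t ≠ 0 → √|t| ≠ 0 := fun t ht => (Real.sqrt_pos.2 (abs_pos.2 ht)).ne'
  have hrr : ∀ t : ℝ, √|t| * √|t| = |t| := fun t => Real.mul_self_sqrt (abs_nonneg t)
  have hsplit : ∀ x t : ℝ, x * |t|⁻¹ = (√|t|)⁻¹ * (x * (√|t|)⁻¹) := fun x t => by
    rw [mul_left_comm, ← mul_inv, hrr]
  -- `K` is chosen to send `|Y|^(-1/2) U` to `|Z|^(-1/2) W`. The factor `U G⁻¹ Uᴴ` is the full
  -- support projection of `Y`, so this prescribes `K` on that whole support.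
  set K := signBlock ri B A * W * Gi * Uᴴ * signBlock r A B with hK
  have hKH : Kᴴ = signBlock r A B * U * Gi * Wᴴ * signBlock ri B A := by
    simp only [hK, conjTranspose_mul, conjTranspose_conjTranspose, hGH, signBlock_conjTranspose,
      Matrix.mul_assoc]
  have hconj : ∀ g : ℝ → ℝ, Kᴴ * signBlock g B A * K =
      signBlock r A B * U * Gi * signSum (fun t => g t * |t|⁻¹) B A * (Gi * Uᴴ *
        signBlock r A B) := by
    intro g
    have e : signSum (fun t => g t * |t|⁻¹) B A =
        Wᴴ * (signBlock ri B A * (signBlock g B A * (signBlock ri B A * W))) := by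
      rw [signSum_congr (h := fun t => ri t * (g t * ri t)), ← signRows_conj, ← signBlock_mul,
        ← signBlock_mul]
      · simp only [Matrix.mul_assoc, hW]
      · exact fun t _ => hsplit (g t) t
    rw [hKH, e, hK]
    simp only [Matrix.mul_assoc]
  have hsandwich : ∀ g : ℝ → ℝ, signBlock r A B * U * Gi * signSum (fun t => g t * |t|⁻¹) A B *
      (Gi * Uᴴ * signBlock r A B) = signBlock g A B := by
    intro g
    rw [← signRows_conj]
    calc _ = signBlock r A B * (U * Gi * Uᴴ) * signBlock (fun t => g t * |t|⁻¹) A B *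
          (U * Gi * Uᴴ) * signBlock r A B := by simp only [Matrix.mul_assoc, hU]
      _ = signBlock g A B := by
        rw [hE, signBlock_mul, signBlock_mul, signBlock_mul, signBlock_mul]
        refine signBlock_congr (fun t ht => ?_) A B
        calc √|t| * 1 * (g t * |t|⁻¹) * 1 * √|t| = g t * (|t|⁻¹ * (√|t| * √|t|)) := by ring
          _ = g t := by rw [hrr, inv_mul_cancel₀ (abs_ne_zero.2 ht), mul_one]
  -- This reduces to `E₊(B) - E₋(A) = E₊(A) - E₋(B)` for the spectral projections, which holds since
  -- `E₊ + E₋ = 1` for both matrices.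
  have hZY : Kᴴ * signBlock (fun t => t) B A * K = signBlock (fun t => t) A B := by
    rw [hconj, ← hsandwich fun t => t]
    congr 2
    have := signSum_sub (k := fun t : ℝ => t * |t|⁻¹) (h := fun _ => 1)
      (fun t ht => by rw [abs_of_pos ht, mul_inv_cancel₀ ht.ne'])
      (fun t ht => by rw [abs_of_neg ht]; field_simp [ht.ne]) hB0 hA0
    rw [cfc_const_one ℝ A hA.isHermitian.isSelfAdjoint,
      cfc_const_one ℝ B hB.isHermitian.isSelfAdjoint, sub_self] at this
    exact sub_eq_zero.1 this
  -- Contractivity is exactly where `B⁻¹ ≤ A⁻¹` enters, with negative parts moved across.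
  have hKK : Kᴴ * K ≤ 1 := by
    have e1 : Kᴴ * K = Kᴴ * signBlock (fun _ => 1) B A * K := by
      rw [hKH]
      conv_rhs => rw [Matrix.mul_assoc _ (signBlock ri B A) (signBlock _ B A), signBlock_mul]
      simp
    have e2 : signSum (fun t => 1 * |t|⁻¹) B A ≤ signSum (fun t => 1 * |t|⁻¹) A B := by
      have := signSum_sub (k := fun t : ℝ => 1 * |t|⁻¹) (h := fun t => t⁻¹)
        (fun t ht => by rw [abs_of_pos ht, one_mul])
        (fun t ht => by rw [abs_of_neg ht, one_mul, inv_neg]) hA0 hB0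
      rw [← sub_nonneg, this]
      exact sub_nonneg.2 hinv
    have e3 : (Gi * Uᴴ * signBlock r A B)ᴴ = signBlock r A B * U * Gi := by
      simp only [conjTranspose_mul, conjTranspose_conjTranspose, hGH, signBlock_conjTranspose,
        Matrix.mul_assoc]
    have e4 := conj_le_conj e2 (Gi * Uᴴ * signBlock r A B)
    rw [e3, hsandwich] at e4
    rw [e1, hconj]
    exact e4.trans (signBlock_one_le A B)
  have hJ := hF.conj_le_of_contraction hF0 (unitSpectrum_signBlock_id hB hA) hKK
  rw [hZY, cfc_signBlock_id hF0 hA.isHermitian hB.isHermitian,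
    cfc_signBlock_id hF0 hB.isHermitian hA.isHermitian] at hJ
  have hJ2 := conj_le_conj hJ (signBlock ri A B * U)
  have hKU : K * (signBlock ri A B * U) = signBlock ri B A * W := by
    have e1 : signBlock r A B * (signBlock ri A B * U) = U := by
      rw [← Matrix.mul_assoc, signBlock_mul, signBlock_congr (h := fun _ => 1),
        hU, signBlock_one_mul_signRows]
      exact fun t ht => mul_inv_cancel₀ (hr0 t ht)
    rw [hK, Matrix.mul_assoc _ (signBlock r A B), e1, Matrix.mul_assoc _ Uᴴ, hU, signRows_gram,
      Matrix.mul_assoc _ Gi, hGG, Matrix.mul_one]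
  have hfin : ∀ C D : Matrix ι ι ℂ, (signBlock ri C D * signRows C D)ᴴ * signBlock F C D *
      (signBlock ri C D * signRows C D) = signSum (fun t => F t * |t|⁻¹) C D := by
    intro C D
    rw [signSum_congr (h := fun t => ri t * (F t * ri t)), ← signRows_conj, ← signBlock_mul,
      ← signBlock_mul, conjTranspose_mul, signBlock_conjTranspose]
    · simp only [Matrix.mul_assoc]
    · exact fun t _ => hsplit (F t) t
  have hRHS : (signBlock ri A B * U)ᴴ * (Kᴴ * signBlock F B A * K) * (signBlock ri A B * U) =
      signSum (fun t => F t * |t|⁻¹) B A := by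
    rw [← hfin B A, ← hW, ← hKU, conjTranspose_mul K]
    simp only [Matrix.mul_assoc]
  rw [hRHS, hU, hfin] at hJ2
  have := signSum_sub (k := fun t : ℝ => F t * |t|⁻¹) (h := fun t => F t / t)
    (fun t ht => by rw [abs_of_pos ht, div_eq_mul_inv])
    (fun t ht => by rw [abs_of_neg ht, inv_neg, div_eq_mul_inv, mul_neg]) hA0 hB0
  rw [← sub_nonpos, ← this]
  exact sub_nonpos.2 hJ2

end Kraus

/-! ### Removing the inverse hypothesis along a segment. -/

section Path

variable {ι : Type} [Fintype ι] [DecidableEq ι]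

/-- With `R = H^(1/2)`, the Woodbury formula writes `X⁻¹ - (X + H)⁻¹` as a conjugate of `(1 + R X⁻¹
R)⁻¹`. Invertibility along the whole segment, rather than positivity of `X`, makes that factor
positive. -/
theorem inv_add_le_inv {X H : Matrix ι ι ℂ} (hX : X.IsHermitian) (hH : 0 ≤ H)
    (hu : ∀ s ∈ Icc (0 : ℝ) 1, IsUnit (X + s • H)) : (X + H)⁻¹ ≤ X⁻¹ := by
  have hRR : CFC.sqrt H * CFC.sqrt H = H := CFC.sqrt_mul_sqrt_self _ hH
  have hR : (CFC.sqrt H)ᴴ = CFC.sqrt H := (CFC.sqrt_nonneg H).posSemidef.isHermitian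
  set R := CFC.sqrt H
  have hXu : IsUnit X := by simpa using hu 0 (by simp)
  have hXX : X * X⁻¹ = 1 := Matrix.mul_nonsing_inv _ ((Matrix.isUnit_iff_isUnit_det _).1 hXu)
  have hXi : X⁻¹ᴴ = X⁻¹ := by rw [conjTranspose_nonsing_inv, hX.eq]
  have hN : (R * X⁻¹ * R).IsHermitian := by
    rw [IsHermitian, conjTranspose_mul, conjTranspose_mul, hR, hXi, Matrix.mul_assoc]
  have hpd : (1 + R * X⁻¹ * R).PosDef := by
    rw [← isStrictlyPositive_iff_posDef, ← cfc_one_add hN,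
      cfc_isStrictlyPositive_iff _ _ (continuousOn_spectrum _ _) hN.isSelfAdjoint]
    intro t ht
    by_contra hlt
    have ht1 : t ≤ -1 := by linarith
    have ht0 : t ≠ 0 := by linarith
    -- An eigenvalue `t ≤ -1` of `R X⁻¹ R` would make `X + s H` singular at `s = -1/t`, a point of
    -- the segment.
    have hs : -t⁻¹ ∈ Icc (0 : ℝ) 1 := by
      rw [← inv_neg]
      exact ⟨inv_nonneg.2 (by linarith), inv_le_one_of_one_le₀ (by linarith)⟩
    have h1 := (Matrix.isUnit_iff_isUnit_det _).1 (hu _ hs)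
    have e : X + (-t⁻¹) • H = X * (1 + ((-t⁻¹) • (X⁻¹ * R)) * R) := by
      rw [Matrix.mul_add, Matrix.mul_one, Matrix.smul_mul, Matrix.mul_smul, ← Matrix.mul_assoc,
        ← Matrix.mul_assoc, hXX, Matrix.one_mul, hRR]
    rw [e, det_mul, det_one_add_mul_comm] at h1
    have h2 : IsUnit (1 + R * ((-t⁻¹) • (X⁻¹ * R))) :=
      (Matrix.isUnit_iff_isUnit_det _).2 (isUnit_of_mul_isUnit_right h1)
    refine ht ?_
    have e2 : algebraMap ℝ (Matrix ι ι ℂ) t - R * X⁻¹ * R =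
        Units.mk0 t ht0 • (1 + R * ((-t⁻¹) • (X⁻¹ * R))) := by
      rw [Units.smul_mk0, smul_add, Matrix.mul_smul, smul_smul, mul_neg, mul_inv_cancel₀ ht0,
        Algebra.algebraMap_eq_smul_one, neg_one_smul, ← sub_eq_add_neg, Matrix.mul_assoc]
    change IsUnit _
    rw [e2]
    exact (isUnit_smul_iff _ _).2 h2
  have hw := Matrix.add_mul_mul_inv_eq_sub X R 1 R hXu isUnit_one (by
    rw [inv_one]; exact hpd.isUnit)
  rw [Matrix.mul_one, hRR, inv_one] at hw
  rw [hw, sub_le_self_iff]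
  have := (hpd.inv.posSemidef.mul_mul_conjTranspose_same (X⁻¹ * R)).nonneg
  rw [conjTranspose_mul, hR, hXi] at this
  simpa only [Matrix.mul_assoc] using this

theorem cfc_inv_eq {X : Matrix ι ι ℂ} (hX : X.IsHermitian) (h0 : (0 : ℝ) ∉ spectrum ℝ X) :
    cfc (fun t : ℝ => t⁻¹) X = X⁻¹ := by
  refine (Matrix.inv_eq_left_inv ?_).symm
  nth_rewrite 2 [← cfc_id' ℝ X hX.isSelfAdjoint]
  rw [← cfc_mul_fun, ← cfc_const_one ℝ X hX.isSelfAdjoint]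
  refine cfc_congr fun t ht => inv_mul_cancel₀ ?_
  rintro rfl
  exact h0 ht

/-- A continuous path in an ordered space which increases on all intervals avoiding a finite set
is increasing. -/
theorem le_of_le_off_finset {E : Type*} [TopologicalSpace E] [Preorder E] [OrderClosedTopology E]
    {ψ : ℝ → E} (s : Finset ℝ) : ∀ {a b : ℝ}, a ≤ b → ContinuousOn ψ (Icc a b) →
    (∀ c d, a ≤ c → c ≤ d → d ≤ b → (∀ z ∈ s, z ∉ Icc c d) → ψ c ≤ ψ d) → ψ a ≤ ψ b := by
  induction s using Finset.induction_on with
  | empty => exact fun {a b} hab _ h => h a b le_rfl hab le_rfl (by simp)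
  | insert z s _ ih =>
    intro a b hab hc h
    by_cases hz : z ∈ Icc a b
    -- The intervals `[a, w]` with `w < z` miss `z`, so the induction hypothesis applies to them;
    -- then let `w → z`.
    · have left : ψ a ≤ ψ z := by
        rcases hz.1.eq_or_lt with rfl | haz
        · exact le_rfl
        have ht : Tendsto ψ (𝓝[Ico a z] z) (𝓝 (ψ z)) :=
          (hc z hz).mono_left (nhdsWithin_mono _ fun x hx => ⟨hx.1, hx.2.le.trans hz.2⟩)
        have : (𝓝[Ico a z] z).NeBot := by
          rw [nhdsWithin_Ico_eq_nhdsLT haz]; infer_instance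
        refine ge_of_tendsto ht ?_
        filter_upwards [self_mem_nhdsWithin] with w hw
        refine ih hw.1 (hc.mono (Icc_subset_Icc le_rfl (hw.2.le.trans hz.2))) ?_
        intro c d h1 h2 h3 h4
        refine h c d h1 h2 (h3.trans (hw.2.le.trans hz.2)) fun y hy hy' => ?_
        rcases Finset.mem_insert.1 hy with rfl | hy
        · exact absurd (hy'.2.trans h3) (not_le.2 hw.2)
        · exact h4 y hy hy'
      have right : ψ z ≤ ψ b := by
        rcases hz.2.eq_or_lt with rfl | hzb
        · exact le_rfl
        have ht : Tendsto ψ (𝓝[Ioc z b] z) (𝓝 (ψ z)) :=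
          (hc z hz).mono_left (nhdsWithin_mono _ fun x hx => ⟨hz.1.trans hx.1.le, hx.2⟩)
        have : (𝓝[Ioc z b] z).NeBot := by
          rw [nhdsWithin_Ioc_eq_nhdsGT hzb]; infer_instance
        refine le_of_tendsto ht ?_
        filter_upwards [self_mem_nhdsWithin] with w hw
        refine ih hw.2 (hc.mono (Icc_subset_Icc (hz.1.trans hw.1.le) le_rfl)) ?_
        intro c d h1 h2 h3 h4
        refine h c d (hz.1.trans (hw.1.le.trans h1)) h2 h3 fun y hy hy' => ?_
        rcases Finset.mem_insert.1 hy with rfl | hy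
        · exact absurd (h1.trans hy'.1) (not_le.2 hw.1)
        · exact h4 y hy hy'
      exact left.trans right
    · refine ih hab hc fun c d h1 h2 h3 h4 => h c d h1 h2 h3 fun y hy hy' => ?_
      rcases Finset.mem_insert.1 hy with rfl | hy
      · exact hz ⟨h1.trans hy'.1, hy'.2.trans h3⟩
      · exact h4 y hy hy'

/-- `det (A + s H)` is a polynomial in `s` that is nonzero at `s = 0`. -/
theorem finite_not_isUnit_add_smul {A : Matrix ι ι ℂ} (hA : IsUnit A) (H : Matrix ι ι ℂ) :
    {s : ℝ | ¬IsUnit (A + s • H)}.Finite := by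
  set p : ℂ[X] := det ((X : ℂ[X]) • H.map C + A.map C) with hp
  have hp0 : p ≠ 0 := by
    intro h
    have := coeff_det_X_add_C_zero H A
    rw [← hp, h, coeff_zero] at this
    exact ((Matrix.isUnit_iff_isUnit_det _).1 hA).ne_zero this.symm
  have heval : ∀ s : ℝ, p.eval (s : ℂ) = det (A + s • H) := by
    intro s
    rw [hp, ← coe_evalRingHom, RingHom.map_det]
    congr 1
    ext i j
    simp only [RingHom.mapMatrix_apply, map_apply, Matrix.add_apply, Matrix.smul_apply, smul_eq_mul,
      coe_evalRingHom, eval_add, eval_mul, eval_X, eval_C, Complex.real_smul]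
    ring
  refine ((p.roots.toFinset.finite_toSet).preimage (f := fun s : ℝ => (s : ℂ))
    Complex.ofReal_injective.injOn).subset fun s hs => ?_
  simp only [mem_preimage, Finset.mem_coe, Multiset.mem_toFinset, mem_roots hp0, IsRoot, heval]
  by_contra h
  exact hs ((Matrix.isUnit_iff_isUnit_det _).2 (isUnit_iff_ne_zero.2 h))

theorem UnitSpectrum.add_smul_sub {A B : Matrix ι ι ℂ} (hA : UnitSpectrum A)
    (hB : UnitSpectrum B) (hAB : A ≤ B) {s : ℝ} (hs : s ∈ Icc (0 : ℝ) 1) :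
    UnitSpectrum (A + s • (B - A)) := by
  have hH := Matrix.le_iff.1 hAB
  constructor
  · rw [← add_assoc]
    exact hA.1.add_posSemidef (hH.smul hs.1)
  · have : 1 - (A + s • (B - A)) = (1 - B) + (1 - s) • (B - A) := by
      rw [sub_smul, one_smul]; abel
    rw [this]
    exact hB.2.add_posSemidef (hH.smul (sub_nonneg.2 hs.2))

open scoped Matrix.Norms.L2Operator in
theorem le_of_path {G : ℝ → ℝ} (hG : ContinuousOn G (Ioo (-1) 1)) {A B : Matrix ι ι ℂ}
    (hA : UnitSpectrum A) (hB : UnitSpectrum B) (hAB : A ≤ B) (s : Finset ℝ)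
    (h : ∀ c d : ℝ, 0 ≤ c → c ≤ d → d ≤ 1 → (∀ z ∈ s, z ∉ Icc c d) →
      cfc G (A + c • (B - A)) ≤ cfc G (A + d • (B - A))) : cfc G A ≤ cfc G B := by
  have hc : ContinuousOn (fun t : ℝ => cfc G (A + t • (B - A))) (Icc 0 1) := by
    refine ContinuousOn.cfc_of_mem_nhdsSet (s := Ioo (-1) 1) G ?_ (by fun_prop)
      (fun t ht => (hA.add_smul_sub hB hAB ht).isHermitian.isSelfAdjoint) hG
    rw [isOpen_Ioo.mem_nhdsSet]
    exact iUnion₂_subset fun t ht => (hA.add_smul_sub hB hAB ht).subset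
  have := le_of_le_off_finset s zero_le_one hc h
  simpa using this

theorem OperatorJensen.cfc_slope_le_of_isUnit {F G : ℝ → ℝ} (hF : OperatorJensen F)
    (hF0 : F 0 = 0) (hFG : ∀ t, t ≠ 0 → G t = F t / t) (hG : ContinuousOn G (Ioo (-1) 1))
    {A B : Matrix ι ι ℂ} (hA : UnitSpectrum A) (hB : UnitSpectrum B) (hAB : A ≤ B)
    (hAu : IsUnit A) : cfc G A ≤ cfc G B := by
  have hfin := finite_not_isUnit_add_smul hAu (B - A)
  refine le_of_path hG hA hB hAB hfin.toFinset fun c d h0 hcd h1 hz => ?_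
  have hu : ∀ s ∈ Icc c d, IsUnit (A + s • (B - A)) := by
    intro s hs
    by_contra hns
    exact hz s (hfin.mem_toFinset.2 hns) hs
  have hH : 0 ≤ B - A := sub_nonneg.2 hAB
  have hstep : ∀ s : ℝ, A + c • (B - A) + s • ((d - c) • (B - A)) =
      A + (c + s * (d - c)) • (B - A) := by intro s; module
  have hend : A + c • (B - A) + (d - c) • (B - A) = A + d • (B - A) := by module
  have hcU := hA.add_smul_sub hB hAB (s := c) ⟨h0, hcd.trans h1⟩
  have hdU := hA.add_smul_sub hB hAB (s := d) ⟨h0.trans hcd, h1⟩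
  have hH' : 0 ≤ (d - c) • (B - A) :=
    ((Matrix.nonneg_iff_posSemidef.1 hH).smul (sub_nonneg.2 hcd)).nonneg
  have hinv := inv_add_le_inv (X := A + c • (B - A)) (H := (d - c) • (B - A)) hcU.isHermitian hH'
    fun s hs => by
      rw [hstep]
      refine hu _ ⟨?_, ?_⟩ <;> nlinarith [hs.1, hs.2]
  rw [hend] at hinv
  have hc0 := (spectrum.zero_notMem_iff ℝ).2 (hu c ⟨le_rfl, hcd⟩)
  have hd0 := (spectrum.zero_notMem_iff ℝ).2 (hu d ⟨hcd, le_rfl⟩)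
  rw [← cfc_inv_eq hcU.isHermitian hc0, ← cfc_inv_eq hdU.isHermitian hd0] at hinv
  have key := hF.cfc_div_le_of_inv_le hF0 hcU hdU hc0 hd0
    (by rw [← hend]; exact le_add_of_nonneg_right hH') hinv
  rwa [cfc_congr (g := G) fun t ht => (hFG t fun h => hc0 (h ▸ ht)).symm,
    cfc_congr (g := G) fun t ht => (hFG t fun h => hd0 (h ▸ ht)).symm] at key

/-- Translating `A` and `B` by a small `ε > 0` makes `A` invertible and keeps the spectra in the
interval. Continuity of `G` then allows `ε → 0`. -/
theorem OperatorJensen.operatorMonotone_slope {F G : ℝ → ℝ} (hF : OperatorJensen F)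
    (hF0 : F 0 = 0) (hFG : ∀ t, t ≠ 0 → G t = F t / t) (hG : ContinuousOn G (Ioo (-1) 1)) :
    OperatorMonotone (Ioo (-1) 1) G := by
  refine .of_cfc_le fun n A B hA hB hAB => ?_
  have hcomp : ∀ {M : Matrix (Fin n) (Fin n) ℂ}, M.IsHermitian → ∀ ε : ℝ,
      cfc (fun t : ℝ => t + ε) M = M + ε • 1 := by
    intro M hM ε
    rw [cfc_add_fun, cfc_id' ℝ M hM.isSelfAdjoint, cfc_const ε M hM.isSelfAdjoint,
      Algebra.algebraMap_eq_smul_one]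
  have hlim : ∀ {M : Matrix (Fin n) (Fin n) ℂ}, UnitSpectrum M →
      Tendsto (fun ε : ℝ => cfc (fun t => G (t + ε)) M) (𝓝[>] 0) (𝓝 (cfc G M)) := by
    intro M hM
    refine tendsto_cfc_of_tendsto fun t ht => ?_
    have h1 : ContinuousAt G t := hG.continuousAt (isOpen_Ioo.mem_nhds (hM.subset ht))
    have h2 : Tendsto (fun ε : ℝ => t + ε) (𝓝[>] 0) (𝓝 t) := by
      have : Tendsto (fun ε : ℝ => t + ε) (𝓝 0) (𝓝 (t + 0)) := Continuous.tendsto (by fun_prop) 0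
      rw [add_zero] at this
      exact this.mono_left nhdsWithin_le_nhds
    exact h1.tendsto.comp h2
  have hunit : ∀ {M : Matrix (Fin n) (Fin n) ℂ}, UnitSpectrum M →
      ∀ᶠ ε in 𝓝[>] (0 : ℝ), UnitSpectrum (M + ε • 1) := by
    intro M hM
    have : ∀ᶠ ε in 𝓝[>] (0 : ℝ), ∀ t ∈ spectrum ℝ M, t + ε ∈ Ioo (-1 : ℝ) 1 := by
      rw [M.finite_real_spectrum.eventually_all]
      intro t ht
      have ht' := hM.subset ht
      filter_upwards [Ioo_mem_nhdsGT (sub_pos.2 ht'.2)] with ε hε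
      exact ⟨by linarith [ht'.1, hε.1], by linarith [hε.2]⟩
    filter_upwards [this] with ε hε
    rw [← hcomp hM.isHermitian]
    exact unitSpectrum_cfc hM.isHermitian hε
  have hinv : ∀ᶠ ε in 𝓝[>] (0 : ℝ), IsUnit (A + ε • 1) := by
    have : ∀ᶠ ε in 𝓝[>] (0 : ℝ), ∀ t ∈ spectrum ℝ A, t + ε ≠ 0 := by
      rw [A.finite_real_spectrum.eventually_all]
      intro t ht
      rcases le_or_gt 0 t with h | h
      · filter_upwards [self_mem_nhdsWithin] with ε hε
        have : (0 : ℝ) < ε := hε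
        linarith
      · filter_upwards [Ioo_mem_nhdsGT (neg_pos.2 h)] with ε hε
        linarith [hε.2]
    filter_upwards [this] with ε hε
    rw [← hcomp hA.isHermitian, ← spectrum.zero_notMem_iff ℝ,
      cfc_map_spectrum _ A hA.isHermitian.isSelfAdjoint (continuousOn_spectrum _ _)]
    rintro ⟨t, ht, h⟩
    exact hε t ht h
  refine matrix_le_of_tendsto (hlim hA) (hlim hB) ?_
  filter_upwards [hunit hA, hunit hB, hinv] with ε h1 h2 h3
  rw [cfc_comp_fun G _ hA.isHermitian, cfc_comp_fun G _ hB.isHermitian, hcomp hA.isHermitian,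
    hcomp hB.isHermitian]
  exact hF.cfc_slope_le_of_isUnit hF0 hFG hG h1 h2 (by gcongr) h3

end Path

/-! ### The backward shift on the cone and its moments. -/

section Cone

theorem OperatorMonotone.add {f g : ℝ → ℝ} (hf : OperatorMonotone (Ioo (-1) 1) f)
    (hg : OperatorMonotone (Ioo (-1) 1) g) : OperatorMonotone (Ioo (-1) 1) (f + g) := by
  refine .of_cfc_le fun n A B hA hB hAB => ?_
  have e : (f + g) = fun t => f t + g t := rfl
  rw [e, cfc_add_fun, cfc_add_fun]
  exact add_le_add (hf.cfc_le hA hB hAB) (hg.cfc_le hA hB hAB)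

theorem OperatorMonotone.smul {f : ℝ → ℝ} (hf : OperatorMonotone (Ioo (-1) 1) f) {c : ℝ}
    (hc : 0 ≤ c) : OperatorMonotone (Ioo (-1) 1) (c • f) := by
  refine .of_cfc_le fun n A B hA hB hAB => ?_
  have e : (c • f) = fun t => c * f t := rfl
  rw [e, cfc_const_mul c f A (continuousOn_spectrum _ _),
    cfc_const_mul c f B (continuousOn_spectrum _ _), Matrix.le_iff, ← smul_sub]
  exact (Matrix.le_iff.1 (hf.cfc_le hA hB hAB)).smul hc

theorem OperatorMonotone.add_const {f : ℝ → ℝ} (hf : OperatorMonotone (Ioo (-1) 1) f) (c : ℝ) :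
    OperatorMonotone (Ioo (-1) 1) fun t => f t + c := by
  refine .of_cfc_le fun n A B hA hB hAB => ?_
  rw [cfc_add_fun, cfc_add_fun, cfc_const c A hA.isHermitian.isSelfAdjoint,
    cfc_const c B hB.isHermitian.isSelfAdjoint]
  gcongr
  exact hf.cfc_le hA hB hAB

theorem OperatorMonotone.continuousOn {f : ℝ → ℝ} (hf : OperatorMonotone (Ioo (-1) 1) f) :
    ContinuousOn f (Ioo (-1) 1) := fun _ hx => (hf.continuousAt hx).continuousWithinAt

theorem zero_mem_Ioo : (0 : ℝ) ∈ Ioo (-1 : ℝ) 1 := by norm_num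

/-- The cone of operator monotone functions on `(-1, 1)` vanishing at `0`. -/
def monotoneCone : Set (ℝ → ℝ) := {f | OperatorMonotone (Ioo (-1) 1) f ∧ f 0 = 0}

theorem monotoneCone_add {f g : ℝ → ℝ} (hf : f ∈ monotoneCone) (hg : g ∈ monotoneCone) :
    f + g ∈ monotoneCone := ⟨hf.1.add hg.1, by simp [hf.2, hg.2]⟩

theorem monotoneCone_smul {f : ℝ → ℝ} (hf : f ∈ monotoneCone) {c : ℝ} (hc : 0 ≤ c) :
    c • f ∈ monotoneCone := ⟨hf.1.smul hc, by simp [hf.2]⟩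

theorem monotoneCone_nonneg {f : ℝ → ℝ} (hf : f ∈ monotoneCone) {x : ℝ} (h0 : 0 ≤ x) (h1 : x < 1) :
    0 ≤ f x := by
  rw [← hf.2]
  exact hf.1.monotoneOn zero_mem_Ioo ⟨by linarith, h1⟩ h0

theorem monotoneCone_nonpos {f : ℝ → ℝ} (hf : f ∈ monotoneCone) {x : ℝ} (h0 : x ≤ 0)
    (h1 : -1 < x) : f x ≤ 0 := by
  rw [← hf.2]
  exact hf.1.monotoneOn ⟨h1, by linarith⟩ zero_mem_Ioo h0

theorem monotoneCone_differentiableAt {f : ℝ → ℝ} (hf : f ∈ monotoneCone) :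
    DifferentiableAt ℝ f 0 := hf.1.differentiableAt zero_mem_Ioo

theorem monotoneCone_deriv_nonneg {f : ℝ → ℝ} (hf : f ∈ monotoneCone) : 0 ≤ deriv f 0 := by
  have h := hf.1.monotoneOn.derivWithin_nonneg (x := 0)
  rwa [derivWithin_of_isOpen isOpen_Ioo zero_mem_Ioo] at h

/-- The backward shift `f ↦ (f(t) - f'(0) t) / t`, for `f(0) = 0`. -/
noncomputable def backwardShift (f : ℝ → ℝ) (t : ℝ) : ℝ := dslope f 0 t - deriv f 0

theorem backwardShift_zero (f : ℝ → ℝ) : backwardShift f 0 = 0 := by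
  simp [backwardShift, dslope_same]

theorem mul_backwardShift {f : ℝ → ℝ} (hf : f 0 = 0) (x : ℝ) :
    f x = x * (deriv f 0 + backwardShift f x) := by
  rcases eq_or_ne x 0 with rfl | hx
  · simp [hf]
  · rw [backwardShift, dslope_of_ne _ hx, slope_def_field, hf]
    field_simp
    ring

theorem backwardShift_add {f g : ℝ → ℝ} (hf : DifferentiableAt ℝ f 0)
    (hg : DifferentiableAt ℝ g 0) :
    backwardShift (f + g) = backwardShift f + backwardShift g := by
  funext t
  rcases eq_or_ne t 0 with rfl | ht
  · simp [backwardShift_zero]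
  · simp only [backwardShift, dslope_of_ne _ ht, slope_def_field, deriv_add hf hg, Pi.add_apply]
    ring

theorem backwardShift_smul (c : ℝ) (f : ℝ → ℝ) :
    backwardShift (c • f) = c • backwardShift f := by
  funext t
  rcases eq_or_ne t 0 with rfl | ht
  · simp [backwardShift_zero]
  · simp only [backwardShift, dslope_of_ne _ ht, slope_def_field, deriv_const_smul_field,
      Pi.smul_apply, smul_eq_mul]
    ring

theorem operatorMonotone_dslope {F : ℝ → ℝ} (hF : OperatorJensen F) (hF0 : F 0 = 0)
    (hc : ContinuousOn F (Ioo (-1) 1)) (hd : DifferentiableAt ℝ F 0) :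
    OperatorMonotone (Ioo (-1) 1) (dslope F 0) :=
  hF.operatorMonotone_slope hF0
    (fun t ht => by rw [dslope_of_ne _ ht, slope_def_field, hF0]; simp)
    ((continuousOn_dslope (isOpen_Ioo.mem_nhds zero_mem_Ioo)).2 ⟨hc, hd⟩)

/-- Up to the constant `f'(0)`, `f + S f` is `(1 + t) f(t) / t`, the slope at `0` of a Jensen
function. -/
theorem monotoneCone_add_backwardShift {f : ℝ → ℝ} (hf : f ∈ monotoneCone) :
    f + backwardShift f ∈ monotoneCone := by
  have hd := monotoneCone_differentiableAt hf
  have hdF : HasDerivAt (fun t => (1 + t) * f t) (deriv f 0) 0 := by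
    have := ((hasDerivAt_id (0 : ℝ)).const_add 1).mul hd.hasDerivAt
    refine this.congr_deriv ?_
    simp [hf.2]
  have h := (operatorMonotone_dslope hf.1.operatorJensen_one_add_mul (by simp [hf.2])
    ((continuousOn_const.add continuousOn_id).mul hf.1.continuousOn)
    hdF.differentiableAt).add_const (-deriv f 0)
  refine ⟨?_, by simp [hf.2, backwardShift_zero]⟩
  convert h using 1
  funext t
  rcases eq_or_ne t 0 with rfl | ht
  · simp [hf.2, backwardShift_zero, dslope_same, hdF.deriv]
  · simp only [Pi.add_apply, backwardShift, dslope_of_ne _ ht, slope_def_field, hf.2]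
    field_simp
    ring

/-- Here the relevant quotient is `(t - 1) f(t) / t`, with the constant `f'(0)` added. -/
theorem monotoneCone_sub_backwardShift {f : ℝ → ℝ} (hf : f ∈ monotoneCone) :
    f - backwardShift f ∈ monotoneCone := by
  have hd := monotoneCone_differentiableAt hf
  have hdF : HasDerivAt (fun t => (t - 1) * f t) (-deriv f 0) 0 := by
    have := ((hasDerivAt_id (0 : ℝ)).sub_const 1).mul hd.hasDerivAt
    refine this.congr_deriv ?_
    simp [hf.2]
  have h := (operatorMonotone_dslope hf.1.operatorJensen_sub_one_mul (by simp [hf.2])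
    ((continuousOn_id.sub continuousOn_const).mul hf.1.continuousOn)
    hdF.differentiableAt).add_const (deriv f 0)
  refine ⟨?_, by simp [hf.2, backwardShift_zero]⟩
  convert h using 1
  funext t
  rcases eq_or_ne t 0 with rfl | ht
  · simp [hf.2, backwardShift_zero, dslope_same, hdF.deriv]
  · simp only [Pi.sub_apply, backwardShift, dslope_of_ne _ ht, slope_def_field, hf.2]
    field_simp
    ring

/-- The linear span of the cone of operator monotone functions vanishing at `0`. -/
noncomputable def coneSpan : Submodule ℝ (ℝ → ℝ) := Submodule.span ℝ monotoneCone

theorem coneSpan_differentiableAt {g : ℝ → ℝ} (hg : g ∈ coneSpan) :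
    DifferentiableAt ℝ g 0 ∧ g 0 = 0 := by
  induction hg using Submodule.span_induction with
  | mem f hf => exact ⟨monotoneCone_differentiableAt hf, hf.2⟩
  | zero => exact ⟨differentiableAt_const 0, rfl⟩
  | add f g _ _ h1 h2 => exact ⟨h1.1.add h2.1, by simp [h1.2, h2.2]⟩
  | smul c f _ h => exact ⟨h.1.const_smul c, by simp [h.2]⟩

/-- `S f` itself need not lie in the cone, but it is the difference of `f + S f` and `f`. Passing to
the span makes `S` an endomorphism, so polynomials in `S` are available. -/
theorem backwardShift_mem_coneSpan {g : ℝ → ℝ} (hg : g ∈ coneSpan) :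
    backwardShift g ∈ coneSpan := by
  induction hg using Submodule.span_induction with
  | mem f hf =>
    have := coneSpan.sub_mem (Submodule.subset_span (monotoneCone_add_backwardShift hf))
      (Submodule.subset_span hf)
    rwa [add_sub_cancel_left] at this
  | zero =>
    have : backwardShift 0 = 0 := by
      simpa using backwardShift_smul 0 (0 : ℝ → ℝ)
    rw [this]
    exact coneSpan.zero_mem
  | add f g hf hg h1 h2 =>
    rw [backwardShift_add (coneSpan_differentiableAt hf).1 (coneSpan_differentiableAt hg).1]
    exact coneSpan.add_mem h1 h2
  | smul c f _ h =>
    rw [backwardShift_smul]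
    exact coneSpan.smul_mem c h

/-- The backward shift as an endomorphism of the span of the cone. -/
noncomputable def coneShift : Module.End ℝ coneSpan where
  toFun g := ⟨backwardShift g, backwardShift_mem_coneSpan g.2⟩
  map_add' f g := Subtype.ext
    (backwardShift_add (coneSpan_differentiableAt f.2).1 (coneSpan_differentiableAt g.2).1)
  map_smul' c f := Subtype.ext (backwardShift_smul c f)

/-- The derivative at `0` on the span of the cone. -/
noncomputable def coneDeriv : coneSpan →ₗ[ℝ] ℝ where
  toFun g := deriv g.1 (0 : ℝ)
  map_add' f g := deriv_add (coneSpan_differentiableAt f.2).1 (coneSpan_differentiableAt g.2).1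
  map_smul' c f := deriv_const_smul_field c f.1

/-- The moment functional `p ↦ (p(S) g)'(0)`, with `S` the backward shift. -/
noncomputable def momentFunctional (g : coneSpan) : ℝ[X] →ₗ[ℝ] ℝ :=
  coneDeriv ∘ₗ LinearMap.applyₗ g ∘ₗ (aeval coneShift).toLinearMap

theorem momentFunctional_apply (g : coneSpan) (p : ℝ[X]) :
    momentFunctional g p = deriv (aeval coneShift p g : coneSpan).1 (0 : ℝ) := rfl

theorem aeval_one_add_mem {g : coneSpan} (hg : (g : ℝ → ℝ) ∈ monotoneCone) (n : ℕ) :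
    ((aeval coneShift ((1 + X : ℝ[X]) ^ n) g : coneSpan) : ℝ → ℝ) ∈ monotoneCone := by
  induction n with
  | zero => simpa using hg
  | succ n ih =>
    have := monotoneCone_add_backwardShift ih
    rw [pow_succ', map_mul, Module.End.mul_apply, map_add, map_one, aeval_X]
    exact this

theorem aeval_one_sub_mem {g : coneSpan} (hg : (g : ℝ → ℝ) ∈ monotoneCone) (n : ℕ) :
    ((aeval coneShift ((1 - X : ℝ[X]) ^ n) g : coneSpan) : ℝ → ℝ) ∈ monotoneCone := by
  induction n with
  | zero => simpa using hg
  | succ n ih =>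
    have := monotoneCone_sub_backwardShift ih
    rw [pow_succ', map_mul, Module.End.mul_apply, map_sub, map_one, aeval_X]
    exact this

/-- The operators `1 + S` and `1 - S` preserve the cone, and derivatives at `0` of its members are
nonnegative. -/
theorem momentFunctional_nonneg {g : coneSpan} (hg : (g : ℝ → ℝ) ∈ monotoneCone) (j k : ℕ) :
    0 ≤ momentFunctional g ((1 + X) ^ j * (1 - X) ^ k) := by
  rw [momentFunctional_apply, map_mul, Module.End.mul_apply]
  exact monotoneCone_deriv_nonneg (aeval_one_add_mem (aeval_one_sub_mem hg k) j)

/-- `f + S g` is half of `(1 + S)(f + g) + (1 - S)(f - g)`, and `f - S g` is half of `(1 - S)(f + g)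
+ (1 + S)(f - g)`. -/
theorem add_sub_coneShift_mem {f g : coneSpan} (h1 : ((f + g : coneSpan) : ℝ → ℝ) ∈ monotoneCone)
    (h2 : ((f - g : coneSpan) : ℝ → ℝ) ∈ monotoneCone) :
    ((f + coneShift g : coneSpan) : ℝ → ℝ) ∈ monotoneCone ∧
    ((f - coneShift g : coneSpan) : ℝ → ℝ) ∈ monotoneCone := by
  have a1 : ((f + g + coneShift (f + g) : coneSpan) : ℝ → ℝ) ∈ monotoneCone :=
    monotoneCone_add_backwardShift h1
  have a2 : ((f + g - coneShift (f + g) : coneSpan) : ℝ → ℝ) ∈ monotoneCone :=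
    monotoneCone_sub_backwardShift h1
  have b1 : ((f - g + coneShift (f - g) : coneSpan) : ℝ → ℝ) ∈ monotoneCone :=
    monotoneCone_add_backwardShift h2
  have b2 : ((f - g - coneShift (f - g) : coneSpan) : ℝ → ℝ) ∈ monotoneCone :=
    monotoneCone_sub_backwardShift h2
  have half : (0 : ℝ) ≤ 1 / 2 := by norm_num
  constructor
  · have e : f + coneShift g = (1 / 2 : ℝ) • ((f + g + coneShift (f + g)) +
        (f - g - coneShift (f - g))) := by
      rw [map_add, map_sub]; module
    rw [e]
    exact monotoneCone_smul (monotoneCone_add a1 b2) half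
  · have e : f - coneShift g = (1 / 2 : ℝ) • ((f + g - coneShift (f + g)) +
        (f - g + coneShift (f - g))) := by
      rw [map_add, map_sub]; module
    rw [e]
    exact monotoneCone_smul (monotoneCone_add a2 b1) half

theorem add_sub_coneShift_pow_mem {g : coneSpan} (hg : (g : ℝ → ℝ) ∈ monotoneCone) (n : ℕ) :
    ((g + (coneShift ^ n) g : coneSpan) : ℝ → ℝ) ∈ monotoneCone ∧
    ((g - (coneShift ^ n) g : coneSpan) : ℝ → ℝ) ∈ monotoneCone := by
  induction n with
  | zero =>
    refine ⟨monotoneCone_add hg hg, ?_⟩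
    have : g - (coneShift ^ 0) g = (0 : ℝ) • g := by simp
    rw [this]
    exact monotoneCone_smul hg le_rfl
  | succ n ih =>
    rw [pow_succ', Module.End.mul_apply]
    exact add_sub_coneShift_mem ih.1 ih.2

/-- Both `g + Sⁿ g` and `g - Sⁿ g` have the sign of `x` at `x`, which bounds the Taylor remainder
uniformly in `n`. -/
theorem abs_coneShift_pow_le {g : coneSpan} (hg : (g : ℝ → ℝ) ∈ monotoneCone) (n : ℕ) {x : ℝ}
    (hx : x ∈ Ioo (-1 : ℝ) 1) :
    |((coneShift ^ n) g : coneSpan).1 x| ≤ |g.1 x| := by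
  obtain ⟨h1, h2⟩ := add_sub_coneShift_pow_mem hg n
  rcases le_total 0 x with h | h
  · have a1 : 0 ≤ g.1 x + ((coneShift ^ n) g).1 x := monotoneCone_nonneg h1 h hx.2
    have a2 : 0 ≤ g.1 x - ((coneShift ^ n) g).1 x := monotoneCone_nonneg h2 h hx.2
    rw [abs_of_nonneg (monotoneCone_nonneg hg h hx.2), abs_le]
    constructor <;> linarith
  · have a1 : g.1 x + ((coneShift ^ n) g).1 x ≤ 0 := monotoneCone_nonpos h1 h hx.1
    have a2 : g.1 x - ((coneShift ^ n) g).1 x ≤ 0 := monotoneCone_nonpos h2 h hx.1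
    rw [abs_of_nonpos (monotoneCone_nonpos hg h hx.1), abs_le]
    constructor <;> linarith

/-- This iterates `g(x) = x (g'(0) + S g(x))`. -/
theorem coneSpan_taylor (g : coneSpan) (n : ℕ) (x : ℝ) :
    g.1 x = ∑ k ∈ Finset.range n, momentFunctional g (X ^ k) * x ^ (k + 1) +
      x ^ n * ((coneShift ^ n) g : coneSpan).1 x := by
  induction n with
  | zero => simp
  | succ n ih =>
    have h := mul_backwardShift (coneSpan_differentiableAt ((coneShift ^ n) g).2).2 x
    have e : ((coneShift ^ (n + 1)) g : coneSpan).1 x =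
        backwardShift ((coneShift ^ n) g : coneSpan) x := by
      rw [pow_succ', Module.End.mul_apply]; rfl
    have e2 : momentFunctional g (X ^ n) = deriv ((coneShift ^ n) g : coneSpan).1 (0 : ℝ) := by
      rw [momentFunctional_apply, map_pow, aeval_X]
    rw [Finset.sum_range_succ, e, e2, ih]
    nth_rewrite 1 [h]
    ring

/-- Functions in the cone are sums of their Taylor series at `0`, with coefficients given by the
moment functional. -/
theorem tendsto_coneSpan_taylor {g : coneSpan} (hg : (g : ℝ → ℝ) ∈ monotoneCone) {x : ℝ}
    (hx : x ∈ Ioo (-1 : ℝ) 1) :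
    Tendsto (fun n => ∑ k ∈ Finset.range n, momentFunctional g (X ^ k) * x ^ (k + 1)) atTop
      (𝓝 (g.1 x)) := by
  have hpow : Tendsto (fun n : ℕ => |x| ^ n * |g.1 x|) atTop (𝓝 0) := by
    have := (tendsto_pow_atTop_nhds_zero_of_lt_one (abs_nonneg x) (abs_lt.2 hx)).mul_const |g.1 x|
    rwa [zero_mul] at this
  have hrem : Tendsto (fun n : ℕ => x ^ n * ((coneShift ^ n) g : coneSpan).1 x) atTop (𝓝 0) := by
    refine squeeze_zero_norm (fun n => ?_) hpow
    rw [norm_mul, norm_pow, Real.norm_eq_abs, Real.norm_eq_abs]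
    exact mul_le_mul_of_nonneg_left (abs_coneShift_pow_le hg n hx) (by positivity)
  have := (tendsto_const_nhds (x := g.1 x)).sub hrem
  rw [sub_zero] at this
  refine this.congr fun n => ?_
  rw [coneSpan_taylor g n x]
  simp

/-- A function in the cone with vanishing derivative at `0` vanishes on `(-1, 1)`. -/
theorem eq_zero_of_deriv_eq_zero {g : coneSpan} (hg : (g : ℝ → ℝ) ∈ monotoneCone)
    (h0 : deriv g.1 0 = 0) {x : ℝ} (hx : x ∈ Ioo (-1 : ℝ) 1) : g.1 x = 0 := by
  -- The derivatives of `g ± Sⁿ g` at `0` are nonnegative, which bounds `|(Sⁿ g)'(0)|` by `g'(0) =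
  -- 0`.
  have hz : ∀ n, momentFunctional g (X ^ n) = 0 := by
    intro n
    obtain ⟨h1, h2⟩ := add_sub_coneShift_pow_mem hg n
    have d1 : 0 ≤ coneDeriv (g + (coneShift ^ n) g) := monotoneCone_deriv_nonneg h1
    have d2 : 0 ≤ coneDeriv (g - (coneShift ^ n) g) := monotoneCone_deriv_nonneg h2
    have e0 : coneDeriv g = 0 := h0
    rw [map_add, e0, zero_add] at d1
    rw [map_sub, e0, zero_sub] at d2
    have e : momentFunctional g (X ^ n) = coneDeriv ((coneShift ^ n) g) := by
      rw [momentFunctional_apply, map_pow, aeval_X]; rfl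
    rw [e]
    linarith
  have := tendsto_coneSpan_taylor hg hx
  simp only [hz, zero_mul, Finset.sum_const_zero] at this
  exact (tendsto_nhds_unique this tendsto_const_nhds)

end Cone

/-! ### The Hausdorff moment problem on `[-1, 1]`. -/

section Moments

open MeasureTheory

theorem integrable_of_continuous_Icc {μ : Measure (Icc (-1 : ℝ) 1)} [IsFiniteMeasure μ]
    {f : Icc (-1 : ℝ) 1 → ℝ} (hf : Continuous f) : Integrable f μ :=
  (BoundedContinuousFunction.mkOfCompact ⟨f, hf⟩).integrable μ

/-- A probability measure on `[-1, 1]` is determined by its moments. -/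
theorem probabilityMeasure_ext_of_moments {μ ν : ProbabilityMeasure (Icc (-1 : ℝ) 1)}
    (h : ∀ n : ℕ, ∫ l, (l : ℝ) ^ n ∂(μ : Measure (Icc (-1 : ℝ) 1)) =
      ∫ l, (l : ℝ) ^ n ∂(ν : Measure (Icc (-1 : ℝ) 1))) : μ = ν := by
  have hpoly : ∀ p : ℝ[X], ∫ l, p.eval (l : ℝ) ∂(μ : Measure (Icc (-1 : ℝ) 1)) =
      ∫ l, p.eval (l : ℝ) ∂(ν : Measure (Icc (-1 : ℝ) 1)) := by
    intro p
    induction p using Polynomial.induction_on' with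
    | add p q hp hq =>
      have ip : ∀ (ρ : ProbabilityMeasure (Icc (-1 : ℝ) 1)) (r : ℝ[X]),
          Integrable (fun l : Icc (-1 : ℝ) 1 => r.eval (l : ℝ)) (ρ : Measure (Icc (-1 : ℝ) 1)) :=
        fun ρ r => integrable_of_continuous_Icc (r.continuous.comp continuous_subtype_val)
      simp only [eval_add]
      rw [integral_add (ip μ p) (ip μ q), integral_add (ip ν p) (ip ν q), hp, hq]
    | monomial n a =>
      simp only [eval_monomial]
      rw [integral_const_mul, integral_const_mul, h]
  suffices key : (μ : Measure (Icc (-1 : ℝ) 1)) = (ν : Measure (Icc (-1 : ℝ) 1)) from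
    Subtype.ext key
  refine ext_of_forall_integral_eq_of_IsFiniteMeasure fun f => ?_
  refine eq_of_forall_dist_le fun ε hε => ?_
  obtain ⟨p, hp⟩ := exists_polynomial_near_continuousMap (-1 : ℝ) 1 f.toContinuousMap (ε / 2)
    (half_pos hε)
  have hclose : ∀ ρ : ProbabilityMeasure (Icc (-1 : ℝ) 1),
      |∫ l, f l ∂(ρ : Measure (Icc (-1 : ℝ) 1)) -
        ∫ l, p.eval (l : ℝ) ∂(ρ : Measure (Icc (-1 : ℝ) 1))| ≤ ε / 2 := by
    intro ρ
    have hp' : Continuous fun l : Icc (-1 : ℝ) 1 => p.eval (l : ℝ) :=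
      p.continuous.comp continuous_subtype_val
    rw [← integral_sub (integrable_of_continuous_Icc f.continuous)
      (integrable_of_continuous_Icc hp')]
    have := norm_integral_le_of_norm_le_const (μ := (ρ : Measure (Icc (-1 : ℝ) 1)))
      (f := fun l : Icc (-1 : ℝ) 1 => f l - p.eval (l : ℝ)) (C := ε / 2)
      (Eventually.of_forall fun l => ?_)
    · simpa using this
    · have h1 := (ContinuousMap.norm_coe_le_norm
        (p.toContinuousMapOn (Icc (-1 : ℝ) 1) - f.toContinuousMap) l).trans hp.le
      rw [norm_sub_rev]
      exact h1
  have h1 := abs_le.1 (hclose μ)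
  have h2 := abs_le.1 (hclose ν)
  rw [hpoly p] at h1
  rw [Real.dist_eq, abs_le]
  constructor <;> linarith [h1.1, h1.2, h2.1, h2.2]

/-- These are the factorial moments of the binomial distribution. They are stated over a commutative
ring because `u` and `v` will be polynomials. -/
theorem sum_choose_mul_choose {R : Type*} [CommRing R] {u v : R} (huv : u + v = 1) {m N : ℕ}
    (hm : m ≤ N) :
    ∑ k ∈ Finset.range (N + 1), (k.choose m : R) * ((N.choose k : R) * (u ^ k * v ^ (N - k))) =
      (N.choose m : R) * u ^ m := by
  obtain ⟨d, rfl⟩ := Nat.exists_eq_add_of_le hm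
  rw [add_assoc, Finset.sum_range_add, Finset.sum_eq_zero, zero_add]
  · have hterm : ∀ j ∈ Finset.range (d + 1), ((m + j).choose m : R) *
        (((m + d).choose (m + j) : R) * (u ^ (m + j) * v ^ (m + d - (m + j)))) =
        ((m + d).choose m : R) * u ^ m * (u ^ j * v ^ (d - j) * (d.choose j : R)) := by
      intro j _
      have h := Nat.choose_mul (n := m + d) (k := m + j) (s := m) (Nat.le_add_right m j)
      rw [Nat.add_sub_cancel_left, Nat.add_sub_cancel_left] at h
      have h' : ((m + d).choose (m + j) : R) * ((m + j).choose m : R) =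
          ((m + d).choose m : R) * (d.choose j : R) := by exact_mod_cast congrArg (Nat.cast (R := R)) h
      rw [Nat.add_sub_add_left, pow_add]
      linear_combination u ^ m * u ^ j * v ^ (d - j) * h'
    rw [Finset.sum_congr rfl hterm, ← Finset.mul_sum, ← add_pow, huv, one_pow, mul_one]
  · intro k hk
    rw [Nat.choose_eq_zero_of_lt (Finset.mem_range.1 hk)]
    simp

/-- The ratio is a product of factors `(k - i) / (N - i)`, truncated at `0`. Each lies in `[0, 1]`
and is within `i / (N - i)` of `k / N`. -/
theorem abs_choose_div_choose_sub_pow_le {N k : ℕ} (hk : k ≤ N) : ∀ {m : ℕ}, m < N →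
    |(k.choose m : ℝ) / (N.choose m : ℝ) - ((k : ℝ) / N) ^ m| ≤ m * (m / ((N : ℝ) - m)) := by
  have hratio : ∀ m : ℕ, (k.choose m : ℝ) / (N.choose m : ℝ) =
      (k.descFactorial m : ℝ) / (N.descFactorial m : ℝ) := by
    intro m
    rw [Nat.descFactorial_eq_factorial_mul_choose, Nat.descFactorial_eq_factorial_mul_choose]
    push_cast
    rw [mul_div_mul_left _ _ (by exact_mod_cast m.factorial_ne_zero)]
  simp only [hratio]
  intro m
  induction m with
  | zero => simp
  | succ m ih =>
    intro hm
    have hmN : m < N := (Nat.lt_succ_self m).trans hm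
    have hN : (0 : ℝ) < N := by exact_mod_cast (Nat.zero_le m).trans_lt hmN
    have hNm : (0 : ℝ) < (N : ℝ) - m := sub_pos.2 (by exact_mod_cast hmN)
    have hNm1 : (0 : ℝ) < (N : ℝ) - (m + 1 : ℕ) := sub_pos.2 (by exact_mod_cast hm)
    have hkN : (k : ℝ) ≤ N := by exact_mod_cast hk
    set r : ℝ := (k.descFactorial m : ℝ) / (N.descFactorial m : ℝ) with hr
    set q : ℝ := ((k - m : ℕ) : ℝ) / ((N - m : ℕ) : ℝ) with hq
    set t : ℝ := (k : ℝ) / N with ht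
    have hstep : (k.descFactorial (m + 1) : ℝ) / (N.descFactorial (m + 1) : ℝ) = q * r := by
      rw [Nat.descFactorial_succ, Nat.descFactorial_succ]
      push_cast
      rw [mul_div_mul_comm]
    have hNmc : ((N - m : ℕ) : ℝ) = (N : ℝ) - m := Nat.cast_sub hmN.le
    have hq0 : 0 ≤ q := by positivity
    have hq1 : q ≤ 1 := by
      rw [hq, hNmc, div_le_one hNm, ← hNmc]
      exact_mod_cast Nat.sub_le_sub_right hk m
    have ht0 : 0 ≤ t := by positivity
    have ht1 : t ≤ 1 := (div_le_one hN).2 hkN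
    have hqt : |q - t| ≤ m / ((N : ℝ) - m) := by
      rw [hq, ht, hNmc]
      rcases le_total m k with hmk | hmk
      · rw [Nat.cast_sub hmk]
        have e : ((k : ℝ) - m) / ((N : ℝ) - m) - (k : ℝ) / N =
            -((m / ((N : ℝ) - m)) * (((N : ℝ) - k) / N)) := by
          field_simp
          ring
        rw [e, abs_neg, abs_of_nonneg (mul_nonneg (by positivity)
          (div_nonneg (by linarith) hN.le))]
        refine mul_le_of_le_one_right (by positivity) ((div_le_one hN).2 ?_)
        linarith [(Nat.cast_nonneg k : (0 : ℝ) ≤ k)]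
      · rw [Nat.sub_eq_zero_of_le hmk, Nat.cast_zero, zero_div, zero_sub, abs_neg,
          abs_of_nonneg (by positivity)]
        have : (k : ℝ) ≤ m := by exact_mod_cast hmk
        exact div_le_div₀ (by positivity) this hNm (by linarith [(Nat.cast_nonneg m : (0 : ℝ) ≤ m)])
    have ihm := ih hmN
    rw [hstep]
    have e : q * r - t ^ (m + 1) = q * (r - t ^ m) + t ^ m * (q - t) := by ring
    have hmono : (m : ℝ) / ((N : ℝ) - m) ≤ (m + 1 : ℕ) / ((N : ℝ) - (m + 1 : ℕ)) :=
      div_le_div₀ (by positivity) (by push_cast; linarith) hNm1 (by push_cast; linarith)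
    calc |q * r - t ^ (m + 1)| ≤ |q * (r - t ^ m)| + |t ^ m * (q - t)| := by
          rw [e]; exact abs_add_le _ _
      _ = q * |r - t ^ m| + t ^ m * |q - t| := by
          rw [abs_mul, abs_mul, abs_of_nonneg hq0, abs_of_nonneg (pow_nonneg ht0 m)]
      _ ≤ 1 * |r - t ^ m| + 1 * |q - t| := by
          gcongr
          exact pow_le_one₀ ht0 ht1
      _ ≤ m * (m / ((N : ℝ) - m)) + m / ((N : ℝ) - m) := by
          rw [one_mul, one_mul]; exact add_le_add ihm hqt
      _ = (m + 1 : ℕ) * (m / ((N : ℝ) - m)) := by push_cast; ring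
      _ ≤ (m + 1 : ℕ) * ((m + 1 : ℕ) / ((N : ℝ) - (m + 1 : ℕ))) := by gcongr

/-- Hausdorff moment problem on `[-1, 1]`: a normalized linear functional on polynomials which is
nonnegative on all `(1 + X) ^ j * (1 - X) ^ k` is integration against a probability measure. -/
theorem exists_probabilityMeasure_of_moments (L : ℝ[X] →ₗ[ℝ] ℝ) (h1 : L 1 = 1)
    (hL : ∀ j k : ℕ, 0 ≤ L ((1 + X) ^ j * (1 - X) ^ k)) :
    ∃ μ : ProbabilityMeasure (Icc (-1 : ℝ) 1),
      ∀ n : ℕ, ∫ l, (l : ℝ) ^ n ∂(μ : Measure (Icc (-1 : ℝ) 1)) = L (X ^ n) := by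
  -- Bernstein's method: `u` and `v` are the barycentric coordinates on `[-1, 1]`. The values of `L`
  -- on the Bernstein basis of degree `N` are the masses of a discrete measure at the points where
  -- `u = k / N`.
  set u : ℝ[X] := C (1 / 2) * (1 + X) with hu
  set v : ℝ[X] := C (1 / 2) * (1 - X) with hv
  have huv : u + v = 1 := by
    rw [hu, hv, ← mul_add, show (1 + X + (1 - X) : ℝ[X]) = C 2 by
      rw [add_add_sub_cancel, one_add_one_eq_two]; rfl, ← C_mul]
    norm_num
  let w : ℕ → ℕ → ℝ := fun N k => L ((N.choose k : ℝ[X]) * (u ^ k * v ^ (N - k)))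
  have hcast : ∀ (n : ℕ) (p : ℝ[X]), L ((n : ℝ[X]) * p) = n * L p := by
    intro n p
    rw [← nsmul_eq_mul, map_nsmul, nsmul_eq_mul]
  have hw0 : ∀ N k, 0 ≤ w N k := by
    intro N k
    simp only [w]
    rw [hcast, hu, hv, mul_pow, mul_pow, ← C_pow, ← C_pow, mul_mul_mul_comm, ← C_mul, ← smul_eq_C_mul,
      map_smul, smul_eq_mul]
    have := hL k (N - k)
    positivity
  have hwm : ∀ {m N : ℕ}, m ≤ N → ∑ k ∈ Finset.range (N + 1), (k.choose m : ℝ) * w N k =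
      N.choose m * L (u ^ m) := by
    intro m N hm
    rw [← hcast, ← sum_choose_mul_choose huv hm, map_sum]
    exact Finset.sum_congr rfl fun k _ => (hcast _ _).symm
  have hw1 : ∀ N, ∑ k ∈ Finset.range (N + 1), w N k = 1 := by
    intro N
    have := hwm (Nat.zero_le N)
    simpa [h1] using this
  let pt : ℕ → ℕ → Icc (-1 : ℝ) 1 := fun N k =>
    projIcc (-1) 1 (by norm_num) (2 * ((k : ℝ) / N) - 1)
  have hpt : ∀ {N k : ℕ}, k ≤ N → 0 < N → (1 + (pt N k : ℝ)) / 2 = (k : ℝ) / N := by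
    intro N k hk hN
    have hN' : (0 : ℝ) < N := by exact_mod_cast hN
    have a0 : 0 ≤ (k : ℝ) / N := by positivity
    have a1 : (k : ℝ) / N ≤ 1 := (div_le_one hN').2 (by exact_mod_cast hk)
    simp only [pt]
    rw [projIcc_of_mem _ ⟨by linarith, by linarith⟩]
    ring
  let M : ℕ → Measure (Icc (-1 : ℝ) 1) := fun N =>
    ∑ k ∈ Finset.range (N + 1), ENNReal.ofReal (w N k) • Measure.dirac (pt N k)
  have hMP : ∀ N, IsProbabilityMeasure (M N) := by
    intro N
    refine ⟨?_⟩
    simp only [M, Measure.coe_finsetSum, Finset.sum_apply, Measure.smul_apply, measure_univ,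
      smul_eq_mul, mul_one]
    rw [← ENNReal.ofReal_sum_of_nonneg fun k _ => hw0 N k, hw1, ENNReal.ofReal_one]
  have hMint : ∀ (N : ℕ) (g : Icc (-1 : ℝ) 1 → ℝ), Continuous g →
      ∫ l, g l ∂(M N) = ∑ k ∈ Finset.range (N + 1), w N k * g (pt N k) := by
    intro N g hg
    simp only [M]
    rw [integral_finsetSum_measure]
    · refine Finset.sum_congr rfl fun k _ => ?_
      rw [integral_smul_measure, integral_dirac, ENNReal.toReal_ofReal (hw0 N k), smul_eq_mul]
    · intro k _
      exact (integrable_of_continuous_Icc hg).smul_measure ENNReal.ofReal_ne_top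
  have hg : ∀ m : ℕ, Continuous fun l : Icc (-1 : ℝ) 1 => ((1 + (l : ℝ)) / 2) ^ m := by
    intro m; fun_prop
  -- The masses reproduce `L (u ^ m)` exactly against `choose k m / choose N m`, which differs from
  -- `(k / N) ^ m` by a term vanishing as `N → ∞`.
  have hlim : ∀ m : ℕ, Tendsto (fun N => ∫ l, ((1 + (l : ℝ)) / 2) ^ m ∂(M N)) atTop
      (𝓝 (L (u ^ m))) := by
    intro m
    rw [tendsto_iff_dist_tendsto_zero]
    have hsmall : Tendsto (fun N : ℕ => (m : ℝ) * (m / ((N : ℝ) - m))) atTop (𝓝 0) := by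
      have := (tendsto_atTop_add_const_right atTop (-(m : ℝ))
        tendsto_natCast_atTop_atTop).const_div_atTop (m : ℝ) |>.const_mul (m : ℝ)
      rw [mul_zero] at this
      exact this
    refine squeeze_zero' (Eventually.of_forall fun _ => dist_nonneg) ?_ hsmall
    filter_upwards [eventually_gt_atTop m] with N hN
    have hC : (N.choose m : ℝ) ≠ 0 := by exact_mod_cast (Nat.choose_pos hN.le).ne'
    have e1 : L (u ^ m) = ∑ k ∈ Finset.range (N + 1),
        w N k * ((k.choose m : ℝ) / (N.choose m : ℝ)) := by
      have := hwm hN.le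
      rw [eq_comm, ← mul_right_inj' hC, ← this, Finset.mul_sum]
      refine Finset.sum_congr rfl fun k _ => ?_
      field_simp
    rw [hMint N _ (hg m), e1, Real.dist_eq, ← Finset.sum_sub_distrib]
    calc |∑ k ∈ Finset.range (N + 1), (w N k * ((1 + (pt N k : ℝ)) / 2) ^ m -
          w N k * ((k.choose m : ℝ) / (N.choose m : ℝ)))|
        ≤ ∑ k ∈ Finset.range (N + 1), |w N k * ((1 + (pt N k : ℝ)) / 2) ^ m -
          w N k * ((k.choose m : ℝ) / (N.choose m : ℝ))| := Finset.abs_sum_le_sum_abs _ _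
      _ ≤ ∑ k ∈ Finset.range (N + 1), w N k * (m * (m / ((N : ℝ) - m))) := by
          refine Finset.sum_le_sum fun k hk => ?_
          have hkN : k ≤ N := Nat.lt_succ_iff.1 (Finset.mem_range.1 hk)
          rw [← mul_sub, abs_mul, abs_of_nonneg (hw0 N k), hpt hkN (by omega), abs_sub_comm]
          exact mul_le_mul_of_nonneg_left (abs_choose_div_choose_sub_pow_le hkN hN) (hw0 N k)
      _ = m * (m / ((N : ℝ) - m)) := by rw [← Finset.sum_mul, hw1, one_mul]
  let P : ℕ → ProbabilityMeasure (Icc (-1 : ℝ) 1) := fun N => ⟨M N, hMP N⟩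
  -- Probability measures on a compact interval form a compact space, and a weak cluster point
  -- inherits the limits of the moments.
  obtain ⟨μ, hμ⟩ := exists_clusterPt_of_compactSpace (map P atTop)
  have hmom : ∀ m : ℕ, ∫ l, ((1 + (l : ℝ)) / 2) ^ m ∂(μ : Measure (Icc (-1 : ℝ) 1)) =
      L (u ^ m) := by
    intro m
    have hcont := ProbabilityMeasure.continuous_integral_boundedContinuousFunction
      (BoundedContinuousFunction.mkOfCompact ⟨_, hg m⟩)
    have hc := MapClusterPt.continuousAt_comp (F := atTop) (u := P) hcont.continuousAt hμ
    have : ClusterPt _ (𝓝 (L (u ^ m))) := ClusterPt.mono hc (hlim m)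
    exact eq_of_nhds_neBot this
  refine ⟨μ, ?_⟩
  have hcomp : ∀ q : ℝ[X], ∫ l, q.eval ((1 + (l : ℝ)) / 2) ∂(μ : Measure (Icc (-1 : ℝ) 1)) =
      L (q.comp u) := by
    intro q
    induction q using Polynomial.induction_on' with
    | add p q hp hq =>
      have ip : ∀ r : ℝ[X], Integrable (fun l : Icc (-1 : ℝ) 1 => r.eval ((1 + (l : ℝ)) / 2))
          (μ : Measure (Icc (-1 : ℝ) 1)) :=
        fun r => integrable_of_continuous_Icc (r.continuous.comp (by fun_prop))
      simp only [eval_add, add_comp, map_add]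
      rw [integral_add (ip p) (ip q), hp, hq]
    | monomial n a =>
      simp only [eval_monomial, monomial_comp]
      rw [integral_const_mul, hmom, ← smul_eq_C_mul, map_smul, smul_eq_mul]
  intro n
  have h := hcomp ((C 2 * X - 1) ^ n)
  have e1 : ((C 2 * X - 1 : ℝ[X]) ^ n).comp u = X ^ n := by
    have : (C 2 * X - 1 : ℝ[X]).comp u = X := by
      rw [sub_comp, mul_comp, C_comp, X_comp, one_comp, hu, ← mul_assoc, ← C_mul]
      norm_num
    rw [pow_comp, this]
  rw [e1] at h
  rw [← h]
  congr 1
  funext l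
  simp only [eval_pow, eval_sub, eval_mul, eval_C, eval_X, eval_one]
  congr 1
  ring

end Moments

/-! ### The kernel `x / (1 - λ x)` and its moments. -/

section Representation

open MeasureTheory

theorem one_sub_abs_le_one_sub_mul (l : Icc (-1 : ℝ) 1) (x : ℝ) : 1 - |x| ≤ 1 - (l : ℝ) * x := by
  have h : |(l : ℝ) * x| ≤ 1 * |x| := by
    rw [abs_mul]
    exact mul_le_mul_of_nonneg_right (abs_le.2 l.2) (abs_nonneg x)
  linarith [le_abs_self ((l : ℝ) * x)]

theorem one_sub_mul_pos (l : Icc (-1 : ℝ) 1) {x : ℝ} (hx : x ∈ Ioo (-1 : ℝ) 1) :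
    0 < 1 - (l : ℝ) * x :=
  lt_of_lt_of_le (sub_pos.2 (abs_lt.2 hx)) (one_sub_abs_le_one_sub_mul l x)

theorem continuous_pow_div_one_sub_mul {x : ℝ} (hx : x ∈ Ioo (-1 : ℝ) 1) (n : ℕ) :
    Continuous fun l : Icc (-1 : ℝ) 1 => (l : ℝ) ^ n / (1 - (l : ℝ) * x) :=
  (continuous_subtype_val.pow n).div
    (continuous_const.sub (continuous_subtype_val.mul continuous_const))
    fun l => (one_sub_mul_pos l hx).ne'

theorem abs_pow_div_one_sub_mul_le (l : Icc (-1 : ℝ) 1) {x : ℝ} (hx : x ∈ Ioo (-1 : ℝ) 1)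
    (n : ℕ) : |(l : ℝ) ^ n / (1 - (l : ℝ) * x)| ≤ 1 / (1 - |x|) := by
  rw [abs_div, abs_of_pos (one_sub_mul_pos l hx), abs_pow]
  exact div_le_div₀ zero_le_one (pow_le_one₀ (abs_nonneg _) (abs_le.2 l.2))
    (sub_pos.2 (abs_lt.2 hx)) (one_sub_abs_le_one_sub_mul l x)

variable (μ : ProbabilityMeasure (Icc (-1 : ℝ) 1))

theorem abs_integral_pow_div_one_sub_mul_le {x : ℝ} (hx : x ∈ Ioo (-1 : ℝ) 1) (n : ℕ) :
    |∫ l, (l : ℝ) ^ n / (1 - (l : ℝ) * x) ∂(μ : Measure (Icc (-1 : ℝ) 1))| ≤ 1 / (1 - |x|) := by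
  simpa using norm_integral_le_of_norm_le_const (μ := (μ : Measure (Icc (-1 : ℝ) 1)))
    (f := fun l => (l : ℝ) ^ n / (1 - (l : ℝ) * x)) (C := 1 / (1 - |x|))
    (Eventually.of_forall fun l => abs_pow_div_one_sub_mul_le l hx n)

/-- The moment generating integrals `∫ lⁿ / (1 - l x) dμ` satisfy a geometric recursion in `n`. -/
theorem integral_pow_div_one_sub_mul_eq {x : ℝ} (hx : x ∈ Ioo (-1 : ℝ) 1) (n : ℕ) :
    ∫ l, (l : ℝ) ^ n / (1 - (l : ℝ) * x) ∂(μ : Measure (Icc (-1 : ℝ) 1)) =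
      ∫ l, (l : ℝ) ^ n ∂(μ : Measure (Icc (-1 : ℝ) 1)) +
        x * ∫ l, (l : ℝ) ^ (n + 1) / (1 - (l : ℝ) * x) ∂(μ : Measure (Icc (-1 : ℝ) 1)) := by
  have hpow : Continuous fun l : Icc (-1 : ℝ) 1 => (l : ℝ) ^ n := continuous_subtype_val.pow n
  rw [← integral_const_mul, ← integral_add (integrable_of_continuous_Icc hpow)
    ((integrable_of_continuous_Icc (continuous_pow_div_one_sub_mul hx (n + 1))).const_mul x)]
  refine integral_congr_ae (Eventually.of_forall fun l => ?_)
  have h := (one_sub_mul_pos l hx).ne'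
  simp only
  field_simp
  ring

theorem integral_div_one_sub_mul_eq (x : ℝ) :
    ∫ l : Icc (-1 : ℝ) 1, x / (1 - (l : ℝ) * x) ∂(μ : Measure (Icc (-1 : ℝ) 1)) =
      x * ∫ l, (l : ℝ) ^ 0 / (1 - (l : ℝ) * x) ∂(μ : Measure (Icc (-1 : ℝ) 1)) := by
  rw [← integral_const_mul]
  refine integral_congr_ae (Eventually.of_forall fun l => ?_)
  simp only [pow_zero, mul_one_div]

/-- Iterating the recursion leaves the remainder `x^(n+1) ∫ lⁿ / (1 - l x)`, whose integral is
bounded by `1 / (1 - |x|)` for every `n`. -/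
theorem tendsto_sum_moments {x : ℝ} (hx : x ∈ Ioo (-1 : ℝ) 1) :
    Tendsto (fun n => ∑ k ∈ Finset.range n,
      (∫ l, (l : ℝ) ^ k ∂(μ : Measure (Icc (-1 : ℝ) 1))) * x ^ (k + 1)) atTop
      (𝓝 (∫ l : Icc (-1 : ℝ) 1, x / (1 - (l : ℝ) * x) ∂(μ : Measure (Icc (-1 : ℝ) 1)))) := by
  have hrem : ∀ n : ℕ, ∑ k ∈ Finset.range n,
      (∫ l, (l : ℝ) ^ k ∂(μ : Measure (Icc (-1 : ℝ) 1))) * x ^ (k + 1) =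
      ∫ l : Icc (-1 : ℝ) 1, x / (1 - (l : ℝ) * x) ∂(μ : Measure (Icc (-1 : ℝ) 1)) -
        (∫ l, (l : ℝ) ^ n / (1 - (l : ℝ) * x) ∂(μ : Measure (Icc (-1 : ℝ) 1))) * x ^ (n + 1) := by
    intro n
    induction n with
    | zero => rw [integral_div_one_sub_mul_eq]; simp [mul_comm]
    | succ n ih =>
      rw [Finset.sum_range_succ, ih, integral_pow_div_one_sub_mul_eq μ hx n]
      ring
  simp only [hrem]
  have hx1 : |x| < 1 := abs_lt.2 hx
  have hzero : Tendsto (fun n : ℕ =>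
      (∫ l, (l : ℝ) ^ n / (1 - (l : ℝ) * x) ∂(μ : Measure (Icc (-1 : ℝ) 1))) * x ^ (n + 1))
      atTop (𝓝 0) := by
    refine squeeze_zero_norm (a := fun n : ℕ => 1 / (1 - |x|) * |x| ^ (n + 1)) (fun n => ?_) ?_
    · rw [norm_mul, norm_pow]
      exact mul_le_mul_of_nonneg_right (abs_integral_pow_div_one_sub_mul_le μ hx n)
        (pow_nonneg (abs_nonneg x) _)
    · simpa using ((tendsto_pow_atTop_nhds_zero_of_lt_one (abs_nonneg x) hx1).comp
        (tendsto_add_atTop_nat 1)).const_mul (1 / (1 - |x|))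
  simpa using hzero.const_sub
    (∫ l : Icc (-1 : ℝ) 1, x / (1 - (l : ℝ) * x) ∂(μ : Measure (Icc (-1 : ℝ) 1)))

theorem tendsto_integral_pow_div_one_sub_mul (n : ℕ) :
    Tendsto (fun x : ℝ => ∫ l, (l : ℝ) ^ n / (1 - (l : ℝ) * x) ∂(μ : Measure (Icc (-1 : ℝ) 1)))
      (𝓝[≠] 0) (𝓝 (∫ l, (l : ℝ) ^ n ∂(μ : Measure (Icc (-1 : ℝ) 1)))) := by
  have hx : ∀ᶠ x in 𝓝[≠] (0 : ℝ), x ∈ Ioo (-1 : ℝ) 1 :=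
    nhdsWithin_le_nhds (isOpen_Ioo.mem_nhds zero_mem_Ioo)
  rw [tendsto_iff_norm_sub_tendsto_zero]
  refine squeeze_zero' (g := fun x : ℝ => |x| * (1 / (1 - |x|)))
    (Eventually.of_forall fun x => norm_nonneg _) ?_ ?_
  · filter_upwards [hx] with x hx
    rw [integral_pow_div_one_sub_mul_eq μ hx n, add_sub_cancel_left, norm_mul]
    exact mul_le_mul_of_nonneg_left (abs_integral_pow_div_one_sub_mul_le μ hx (n + 1))
      (norm_nonneg x)
  · have h : ContinuousAt (fun x : ℝ => |x| * (1 / (1 - |x|))) 0 := by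
      refine continuous_abs.continuousAt.mul
        (continuousAt_const.div (continuousAt_const.sub continuous_abs.continuousAt) ?_)
      simp
    have h' := h.tendsto
    simp only [abs_zero, zero_mul] at h'
    exact h'.mono_left nhdsWithin_le_nhds

variable {μ} {ν : ProbabilityMeasure (Icc (-1 : ℝ) 1)}

/-- A probability measure on `[-1, 1]` is determined by the integrals of `x / (1 - l x)`. -/
theorem probabilityMeasure_ext_of_integral_div_one_sub_mul
    (h : ∀ x ∈ Ioo (-1 : ℝ) 1,
      ∫ l : Icc (-1 : ℝ) 1, x / (1 - (l : ℝ) * x) ∂(μ : Measure (Icc (-1 : ℝ) 1)) =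
        ∫ l : Icc (-1 : ℝ) 1, x / (1 - (l : ℝ) * x) ∂(ν : Measure (Icc (-1 : ℝ) 1))) :
    μ = ν := by
  have hx : ∀ᶠ x in 𝓝[≠] (0 : ℝ), x ∈ Ioo (-1 : ℝ) 1 :=
    nhdsWithin_le_nhds (isOpen_Ioo.mem_nhds zero_mem_Ioo)
  have hlim : ∀ n : ℕ, (∀ x ∈ Ioo (-1 : ℝ) 1, x ≠ 0 →
      ∫ l, (l : ℝ) ^ n / (1 - (l : ℝ) * x) ∂(μ : Measure (Icc (-1 : ℝ) 1)) =
        ∫ l, (l : ℝ) ^ n / (1 - (l : ℝ) * x) ∂(ν : Measure (Icc (-1 : ℝ) 1))) →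
      ∫ l, (l : ℝ) ^ n ∂(μ : Measure (Icc (-1 : ℝ) 1)) =
        ∫ l, (l : ℝ) ^ n ∂(ν : Measure (Icc (-1 : ℝ) 1)) := by
    intro n hn
    refine tendsto_nhds_unique (tendsto_integral_pow_div_one_sub_mul μ n)
      ((tendsto_integral_pow_div_one_sub_mul ν n).congr' ?_)
    filter_upwards [hx, self_mem_nhdsWithin] with x hx hx0
    exact (hn x hx hx0).symm
  -- Letting `x → 0` in the `n`-th integrals identifies the `n`-th moments. Subtracting these and
  -- dividing by `x` gives the next integrals.
  have hall : ∀ n : ℕ, ∀ x ∈ Ioo (-1 : ℝ) 1, x ≠ 0 →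
      ∫ l, (l : ℝ) ^ n / (1 - (l : ℝ) * x) ∂(μ : Measure (Icc (-1 : ℝ) 1)) =
        ∫ l, (l : ℝ) ^ n / (1 - (l : ℝ) * x) ∂(ν : Measure (Icc (-1 : ℝ) 1)) := by
    intro n
    induction n with
    | zero =>
      intro x hx hx0
      have h1 := h x hx
      rw [integral_div_one_sub_mul_eq, integral_div_one_sub_mul_eq] at h1
      exact mul_left_cancel₀ hx0 h1
    | succ n ih =>
      intro x hx hx0
      have h1 := ih x hx hx0
      rw [integral_pow_div_one_sub_mul_eq μ hx n, integral_pow_div_one_sub_mul_eq ν hx n,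
        hlim n ih] at h1
      exact mul_left_cancel₀ hx0 (add_left_cancel h1)
  exact probabilityMeasure_ext_of_moments fun n => hlim n (hall n)

end Representation

/-! ### The representation theorem. -/

theorem theorem2p7p5 (f : ℝ → ℝ) (hf : OperatorMonotone (Set.Ioo (-1 : ℝ) 1) f)
    (hnc : ¬ ∃ c : ℝ, ∀ x ∈ Set.Ioo (-1 : ℝ) 1, f x = c) :
    DifferentiableAt ℝ f 0 ∧
    ∃! μ : MeasureTheory.ProbabilityMeasure (Set.Icc (-1 : ℝ) 1),
      ∀ x ∈ Set.Ioo (-1 : ℝ) 1,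
        f x = f 0 + deriv f 0 *
          ∫ l : Set.Icc (-1 : ℝ) 1, x / (1 - (l : ℝ) * x)
            ∂(μ : MeasureTheory.Measure (Set.Icc (-1 : ℝ) 1)) := by
  have hg : (fun t => f t + -f 0) ∈ monotoneCone := ⟨hf.add_const (-f 0), by simp⟩
  have hderiv : deriv (fun t => f t + -f 0) 0 = deriv f 0 := deriv_add_const _
  -- Nonconstancy is used here only, to allow normalization by `f'(0)`.
  have hc : deriv f 0 ≠ 0 := by
    intro h0
    refine hnc ⟨f 0, fun x hx => ?_⟩
    have := eq_zero_of_deriv_eq_zero (g := ⟨_, Submodule.subset_span hg⟩) hg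
      (hderiv.trans h0) hx
    simp only at this
    linarith
  have hc0 : 0 ≤ deriv f 0 := hderiv ▸ monotoneCone_deriv_nonneg hg
  refine ⟨hf.differentiableAt zero_mem_Ioo, ?_⟩
  set g : coneSpan := ⟨_, Submodule.subset_span hg⟩ with hgdef
  obtain ⟨μ, hμ⟩ := exists_probabilityMeasure_of_moments ((deriv f 0)⁻¹ • momentFunctional g)
    (by
      rw [LinearMap.smul_apply, momentFunctional_apply, map_one, Module.End.one_apply, smul_eq_mul]
      exact hderiv ▸ inv_mul_cancel₀ (hderiv ▸ hc))
    (fun j k => by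
      rw [LinearMap.smul_apply, smul_eq_mul]
      exact mul_nonneg (inv_nonneg.2 hc0) (momentFunctional_nonneg hg j k))
  have hrep : ∀ x ∈ Ioo (-1 : ℝ) 1, f x = f 0 + deriv f 0 *
      ∫ l : Icc (-1 : ℝ) 1, x / (1 - (l : ℝ) * x) ∂(μ : MeasureTheory.Measure (Icc (-1 : ℝ) 1)) := by
    intro x hx
    have h1 := (tendsto_sum_moments μ hx).const_mul (deriv f 0)
    have h2 := tendsto_coneSpan_taylor (g := g) hg hx
    -- Both sides are sums of the same power series: its coefficients are the moments of `μ` scaled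
    -- by `f'(0)`.
    have h3 := tendsto_nhds_unique (h1.congr fun n => ?_) h2
    · rw [h3]
      simp [hgdef]
    · rw [Finset.mul_sum]
      refine Finset.sum_congr rfl fun k _ => ?_
      rw [hμ k, LinearMap.smul_apply, smul_eq_mul, ← mul_assoc, mul_inv_cancel_left₀ hc]
  refine ⟨μ, hrep, fun ν hν => ?_⟩
  refine probabilityMeasure_ext_of_integral_div_one_sub_mul fun x hx => ?_
  exact mul_left_cancel₀ hc (add_left_cancel ((hν x hx).symm.trans (hrep x hx)))
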